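/- **Theorem (Rate of convergence).** Let $\mathcal H=L^2([0,1])$ (real-valued functions), write $(f\otimes g)(h)=\langle g,h\rangle f$, and let $\|\cdot\|_{\mathrm{op}}$, $\|\cdot\|_{\mathrm{HS}}$ be the operator and Hilbert–Schmidt norms. Assume the following. 1. $(X_t)_{t\in\mathbb Z}$ is a strictly stationary $\mathcal H$-valued process satisfying $X_t=\Psi X_{t-1}+\varepsilon_t$ almost surely for every $t\in\mathbb Z$, where $\Psi$ is a bounded linear operator on $\mathcal H$ with $\|\Psi\|_{\mathrm{op}}<1$ and $(\varepsilon_t)_{t\in\mathbb Z}$ are i.i.d. with $\mathbb E\varepsilon_t=0$ and $\mathbb E\|\varepsilon_t\|^4<\infty$. (Then $\mathbb E X_t=0$.) 2. The covariance operator $C_0=\mathbb E[X_t\otimes X_t]$ is injective, compact and of trace class, and its eigenvalues $\lambda_1\ge\lambda_2\ge\dots>0$ (counted with multiplicity, with an orthonormal basis of eigenvectors $\phi_1,\phi_2,\dots$) satisfy $c_1k^{-a}\le\lambda_k\le c_2k^{-a}$ for all $k\ge1$, for some constants $0<c_1\le c_2<\infty$ and $a>1$. 3. $\Psi=F\,C_0^{\beta}$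 for some $\beta>0$ and some Hilbert–Schmidt operator $F$ with $\|F\|_{\mathrm{HS}}\le\rho<\infty$, where $C_0^\beta=\sum_k\lambda_k^\beta\,\phi_k\otimes\phi_k$. 4. $(X_t)$ is $L^4$-$m$-approximable: $\mathbb E\|X_t\|^4<\infty$, $X_t=f(e_t,e_{t-1},\dots)$ almost surely for i.i.d. random elements $(e_t)_{t\in\mathbb Z}$ of a measurable space and a measurable map $f$, and $\sum_{m\ge1}\bigl(\mathbb E\|X_t-X_t^{(m)}\|^4\bigr)^{1/4}<\infty$ for every $t$, where $X_t^{(m)}=f(e_t,\dots,e_{t-m+1},e'_{t-m},e'_{t-m-1},\dots)$ and $(e'_t)$ is an independent copy of $(e_t)$. For $n\ge 2$ let $\bar X=n^{-1}\sum_{t=1}^nX_t$, $$\widehat C_0=\frac1n\sum_{t=1}^n(X_t-\bar X)\otimes(X_t-\bar X),\qquad \widehat C_1=\frac1{n-1}\sum_{t=1}^{n-1}(X_{t+1}-\bar X)\otimes(X_t-\bar X),$$ and for $\alpha>0$ let $\widehat\Psi_\alpha=\widehat C_1(\widehat C_0+\alpha I)^{-1}$ be the Tikhonov estimator. Let $(\alpha_n)$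 be any deterministic sequence of positive numbers with $\alpha_n\asymp n^{-1/(2(\min(\beta,1)+1))}$. Then $$\bigl\|\widehat\Psi_{\alpha_n}-\Psi\bigr\|_{\mathrm{HS}}=O_P\bigl(n^{-\min(\beta,1)/(2(\min(\beta,1)+1))}\bigr)\qquad(n\to\infty).$$ In particular the rate is $n^{-1/4}$ for $\beta\ge1$, and $n^{-\beta/(2(\beta+1))}$ for $\beta\in(0,1]$. -/

import Mathlib

open MeasureTheory ProbabilityTheory Filter
open scoped ENNReal Topology

/-- The Hilbert space `L²([0,1])` of real-valued functions. -/
abbrev L2I : Type := Lp ℝ 2 (volume.restrict (Set.Icc (0 : ℝ) 1))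

/-- `L²([0,1])` carries its Borel sigma-algebra. -/
noncomputable instance instMeasurableSpaceL2I : MeasurableSpace L2I := borel L2I

instance instBorelSpaceL2I : BorelSpace L2I := ⟨rfl⟩

namespace FAR

section Operators

variable {H : Type*} [NormedAddCommGroup H] [InnerProductSpace ℝ H] [CompleteSpace H]

set_option linter.unusedSectionVars false

/-- `∑ᵢ ‖A bᵢ‖²` along an orthonormal basis, with value in `[0,∞]`. -/
noncomputable def hsSqAlong {ι : Type*} (b : HilbertBasis ι ℝ H) (A : H →L[ℝ] H) : ℝ≥0∞ :=
  ∑' i, ‖A (b i)‖ₑ ^ 2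

/-- The Hilbert–Schmidt norm of a bounded operator, with value in `[0,∞]` (it is `∞` exactly when
the operator is not Hilbert–Schmidt); computed in a fixed orthonormal basis, the choice of which
is irrelevant by `hsNorm_eq`. -/
noncomputable def hsNorm (A : H →L[ℝ] H) : ℝ≥0∞ :=
  (hsSqAlong (exists_hilbertBasis ℝ H).choose_spec.choose A) ^ (1 / 2 : ℝ)

/-- Parseval's identity in `[0,∞]`. -/
theorem parseval_enorm {ι : Type*} (b : HilbertBasis ι ℝ H) (x : H) :
    ∑' i, ‖inner ℝ x (b i)‖ₑ ^ 2 = ‖x‖ₑ ^ 2 := by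
  have h : HasSum (fun i => ‖inner ℝ x (b i)‖ ^ 2) (‖x‖ ^ 2) := by
    have h1 := b.hasSum_inner_mul_inner x x
    rw [real_inner_self_eq_norm_sq] at h1
    refine h1.congr_fun ?_
    intro i
    rw [real_inner_comm x (b i), Real.norm_eq_abs, sq_abs, sq]
  have h2 := ENNReal.ofReal_tsum_of_nonneg (fun i => sq_nonneg ‖inner ℝ x (b i)‖) h.summable
  rw [h.tsum_eq] at h2
  simp only [ENNReal.ofReal_pow (norm_nonneg _), ofReal_norm] at h2
  exact h2.symm

theorem hsSqAlong_adjoint {ι κ : Type*} (b : HilbertBasis ι ℝ H) (c : HilbertBasis κ ℝ H)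
    (A : H →L[ℝ] H) : hsSqAlong b A = hsSqAlong c (ContinuousLinearMap.adjoint A) := by
  unfold hsSqAlong
  calc ∑' i, ‖A (b i)‖ₑ ^ 2 = ∑' i, ∑' j, ‖inner ℝ (A (b i)) (c j)‖ₑ ^ 2 := by
        simp only [parseval_enorm]
    _ = ∑' j, ∑' i, ‖inner ℝ (A (b i)) (c j)‖ₑ ^ 2 := ENNReal.tsum_comm
    _ = ∑' j, ∑' i, ‖inner ℝ (ContinuousLinearMap.adjoint A (c j)) (b i)‖ₑ ^ 2 := by
        simp only [ContinuousLinearMap.adjoint_inner_left, real_inner_comm]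
    _ = _ := by simp only [parseval_enorm]

/-- The Hilbert–Schmidt norm can be computed in any orthonormal basis. -/
theorem hsNorm_eq {ι : Type*} (b : HilbertBasis ι ℝ H) (A : H →L[ℝ] H) :
    hsNorm A = (∑' i, ‖A (b i)‖ₑ ^ 2) ^ (1 / 2 : ℝ) := by
  unfold hsNorm
  rw [hsSqAlong_adjoint _ b A, ← hsSqAlong_adjoint b b A]
  rfl

/-- Trace class operators: products of two Hilbert–Schmidt operators. -/
def IsTraceClass (A : H →L[ℝ] H) : Prop :=
  ∃ B D : H →L[ℝ] H, hsNorm B < ∞ ∧ hsNorm D < ∞ ∧ A = B ∘L D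

/-- `φ` is an orthonormal basis of eigenvectors of `C`, and `lam` is the non-increasing sequence of
the corresponding eigenvalues (counted with multiplicity); the index starts at `0`. -/
structure IsEigensystem (C : H →L[ℝ] H) (φ : HilbertBasis ℕ ℝ H) (lam : ℕ → ℝ) : Prop where
  antitone : Antitone lam
  apply_eq : ∀ k, C (φ k) = lam k • φ k

/-- The fractional power `C ^ β = ∑ₖ λₖ ^ β φₖ ⊗ φₖ` of a compact positive operator with eigensystem
`(φ, lam)`, the series converging in operator norm
(see `summable_diag` and `spectralPow_apply`). -/
noncomputable def spectralPow (φ : HilbertBasis ℕ ℝ H) (lam : ℕ → ℝ) (β : ℝ) : H →L[ℝ] H :=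
  ∑' k, lam k ^ β • InnerProductSpace.rankOne ℝ (φ k) (φ k)

theorem norm_diag_le (φ : HilbertBasis ℕ ℝ H) (w : ℕ → ℝ) (s : Finset ℕ) (ε : ℝ) (hε : 0 ≤ ε)
   (hw : ∀ k ∈ s, |w k| ≤ ε) : ‖∑ k ∈ s, w k • InnerProductSpace.rankOne ℝ (φ k) (φ k)‖ ≤ ε := by
  refine ContinuousLinearMap.opNorm_le_bound _ hε fun x => ?_
  have h1 : (∑ k ∈ s, w k • InnerProductSpace.rankOne ℝ (φ k) (φ k)) x
     = ∑ k ∈ s, (w k * inner ℝ (φ k) x) • φ k := by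
    simp [smul_smul]
  rw [h1]
  refine abs_le_of_sq_le_sq' ?_ (by positivity) |>.2
  rw [← real_inner_self_eq_norm_sq, φ.orthonormal.inner_sum]
  have h2 := φ.orthonormal.sum_inner_products_le x (s := s)
  calc _ ≤ ∑ k ∈ s, ε^2 * ‖inner ℝ (φ k) x‖^2 := by
        refine Finset.sum_le_sum fun k hk => ?_
        simp only [conj_trivial, Real.norm_eq_abs, sq_abs]
        have : w k ^2 ≤ ε^2 := sq_le_sq' (by linarith [neg_abs_le (w k), hw k hk]) ((le_abs_self _).trans (hw k hk))
        nlinarith [sq_nonneg (inner ℝ (φ k) x)]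
    _ ≤ _ := by rw [← Finset.mul_sum, mul_pow]; gcongr

theorem summable_diag (φ : HilbertBasis ℕ ℝ H) (w : ℕ → ℝ) (hw : Tendsto w atTop (𝓝 0)) :
   Summable fun k => w k • InnerProductSpace.rankOne ℝ (φ k) (φ k) := by
  rw [summable_iff_vanishing_norm]
  intro ε hε
  obtain ⟨N, hN⟩ := Metric.tendsto_atTop.1 hw (ε/2) (by positivity)
  refine ⟨Finset.range N, fun t ht => ?_⟩
  refine (norm_diag_le φ w t (ε/2) (by positivity) fun k hk => ?_).trans_lt (by linarith)
  have := hN k (by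
    by_contra h
    exact Finset.disjoint_left.1 ht hk (by simpa using h))
  simpa using this.le

/-- `C ^ β` acts on the eigenvectors as it should. -/
theorem spectralPow_apply (φ : HilbertBasis ℕ ℝ H) (lam : ℕ → ℝ) (β : ℝ) (hβ : 0 < β)
    (h : Tendsto lam atTop (𝓝 0)) (k : ℕ) :
    spectralPow φ lam β (φ k) = lam k ^ β • φ k := by
  have hs := summable_diag φ (fun k => lam k ^ β) (by
    have := h.rpow_const (p := β) (Or.inr hβ.le)
    simpa [Real.zero_rpow hβ.ne'] using this)
  unfold spectralPow
  have h2 := (ContinuousLinearMap.apply ℝ H (φ k)).hasSum hs.hasSum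
  simp only [ContinuousLinearMap.apply_apply] at h2
  rw [← h2.tsum_eq, tsum_eq_single k]
  · simp [φ.orthonormal.1 k]
  · intro b hb
    simp [φ.orthonormal.2 hb]

/-- `X̄ = n⁻¹ ∑_{t=1}^n X_t`. -/
noncomputable def sampleMean (n : ℕ) (x : ℤ → H) : H :=
  (n : ℝ)⁻¹ • ∑ t ∈ Finset.Icc 1 n, x t

/-- `Ĉ₀ = n⁻¹ ∑_{t=1}^n (X_t - X̄) ⊗ (X_t - X̄)`. -/
noncomputable def sampleC0 (n : ℕ) (x : ℤ → H) : H →L[ℝ] H :=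
  (n : ℝ)⁻¹ • ∑ t ∈ Finset.Icc 1 n,
    InnerProductSpace.rankOne ℝ (x t - sampleMean n x) (x t - sampleMean n x)

/-- `Ĉ₁ = (n - 1)⁻¹ ∑_{t=1}^{n-1} (X_{t+1} - X̄) ⊗ (X_t - X̄)`. -/
noncomputable def sampleC1 (n : ℕ) (x : ℤ → H) : H →L[ℝ] H :=
  ((n : ℝ) - 1)⁻¹ • ∑ t ∈ Finset.Ico 1 n,
    InnerProductSpace.rankOne ℝ (x (t + 1) - sampleMean n x) (x t - sampleMean n x)

/-- The Tikhonov estimator `Ĉ₁ (Ĉ₀ + α I)⁻¹` (`Ĉ₀ + α I` is invertible for `α > 0`, see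
`isUnit_sampleC0_add`). -/
noncomputable def tikhonov (n : ℕ) (α : ℝ) (x : ℤ → H) : H →L[ℝ] H :=
  sampleC1 n x ∘L Ring.inverse (sampleC0 n x + α • ContinuousLinearMap.id ℝ H)

theorem isUnit_sampleC0_add (n : ℕ) {α : ℝ} (hα : 0 < α) (x : ℤ → H) :
    IsUnit (sampleC0 n x + α • ContinuousLinearMap.id ℝ H) := by
  refine ContinuousLinearMap.isUnit_of_forall_le_norm_inner_map _ (c := ⟨α, hα.le⟩) hα ?_
  intro y
  have h : inner ℝ ((sampleC0 n x + α • ContinuousLinearMap.id ℝ H) y) y =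
      (n : ℝ)⁻¹ * ∑ t ∈ Finset.Icc 1 n, inner ℝ (x t - sampleMean n x) y ^ 2 + α * ‖y‖ ^ 2 := by
    have h1 : ∀ z : ℤ → H, inner ℝ ((∑ t ∈ Finset.Icc 1 n,
        InnerProductSpace.rankOne ℝ (z t) (z t)) y) y =
          ∑ t ∈ Finset.Icc 1 n, inner ℝ (z t) y ^ 2 := by
      intro z
      simp [real_inner_smul_left, sum_inner, sq]
    rw [← h1 fun t => x t - sampleMean n x]
    simp only [sampleC0, add_apply, inner_add_left, smul_apply, real_inner_smul_left,
      ContinuousLinearMap.id_apply, real_inner_self_eq_norm_sq]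
  have h0 : 0 ≤ (n : ℝ)⁻¹ * ∑ t ∈ Finset.Icc 1 n, inner ℝ (x t - sampleMean n x) y ^ 2 := by
    positivity
  rw [h, Real.norm_eq_abs]
  refine le_trans ?_ (le_abs_self _)
  change ‖y‖ ^ 2 * α ≤ _
  linarith

end Operators

section Processes

variable {Ω : Type*} [MeasurableSpace Ω]
  {H : Type*} [NormedAddCommGroup H] [InnerProductSpace ℝ H] [CompleteSpace H]
  [MeasurableSpace H]

/-- Strict stationarity: the law of the whole process is invariant under time shifts. -/
def StrictlyStationary (P : Measure Ω) (X : ℤ → Ω → H) : Prop :=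
  ∀ h : ℤ, IdentDistrib (fun ω t => X (t + h) ω) (fun ω t => X t ω) P P

/-- `X` is a stationary solution of `X_t = Ψ X_{t-1} + ε_t`, `t ∈ ℤ`, with `‖Ψ‖ < 1` and i.i.d.
centred innovations with finite fourth moment. -/
structure IsStationaryFAR1 (P : Measure Ω) (Ψ : H →L[ℝ] H) (X ε : ℤ → Ω → H) : Prop where
  measurable_X : ∀ t, Measurable (X t)
  measurable_ε : ∀ t, Measurable (ε t)
  norm_lt_one : ‖Ψ‖ < 1
  recursion : ∀ t, ∀ᵐ ω ∂P, X t ω = Ψ (X (t - 1) ω) + ε t ω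
  stationary : StrictlyStationary P X
  indep : iIndepFun ε P
  identDistrib : ∀ t, IdentDistrib (ε t) (ε 0) P P
  memLp : ∀ t, MemLp (ε t) 4 P
  mean_zero : ∀ t, ∫ ω, ε t ω ∂P = 0

/-- The covariance operator `E[Y ⊗ Y]` of a centred random element `Y`, a Bochner integral in the
space of bounded operators. -/
noncomputable def covOp (P : Measure Ω) (Y : Ω → H) : H →L[ℝ] H :=
  ∫ ω, InnerProductSpace.rankOne ℝ (Y ω) (Y ω) ∂P

/-- `L^p`-`m`-approximability: `X_t = f(e_t, e_{t-1}, …)` for i.i.d. `e_t` and a measurable `f`, and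
`∑ₘ ‖X_t - X_t^{(m)}‖_{L^p} < ∞` where
`X_t^{(m)} = f(e_t, …, e_{t-m+1}, e'_{t-m}, e'_{t-m-1}, …)` for an independent copy `e'` of `e`
(realised on the second factor of `Ω × Ω`); the sum is over `m ≥ 1`, written as `m + 1` with `m : ℕ`. -/
def LpMApproximable (p : ℝ≥0∞) (P : Measure Ω) (X : ℤ → Ω → H) : Prop :=
  (∀ t, MemLp (X t) p P) ∧
  ∃ (S : Type) (_ : MeasurableSpace S) (e : ℤ → Ω → S) (f : (ℕ → S) → H),
    (∀ t, Measurable (e t)) ∧ Measurable f ∧ iIndepFun e P ∧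
    (∀ t, IdentDistrib (e t) (e 0) P P) ∧
    (∀ t, ∀ᵐ ω ∂P, X t ω = f fun j => e (t - j) ω) ∧
    ∀ t, ∑' m : ℕ, eLpNorm
      (fun ω : Ω × Ω => f (fun j => e (t - j) ω.1) -
        f (fun j => if j < m + 1 then e (t - j) ω.1 else e (t - j) ω.2)) p (P.prod P) < ∞

end Processes

/-- `Y n = O_P(r n)` as `n → ∞`, for `[0,∞]`-valued `Y n`. -/
def IsBigOInProb {Ω : Type*} [MeasurableSpace Ω] (P : Measure Ω) (Y : ℕ → Ω → ℝ≥0∞)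
    (r : ℕ → ℝ) : Prop :=
  ∀ η : ℝ, 0 < η → ∃ M : ℝ, 0 < M ∧
    ∀ᶠ n in atTop, P {ω | ENNReal.ofReal (M * r n) < Y n ω} ≤ ENNReal.ofReal η

/-- The operator is injective, compact and of trace class, and its eigenvalues decay like `k ^ (-a)`
with `a > 1`. -/
structure CovarianceCondition {H : Type*} [NormedAddCommGroup H] [InnerProductSpace ℝ H]
    [CompleteSpace H] (C : H →L[ℝ] H) (φ : HilbertBasis ℕ ℝ H) (lam : ℕ → ℝ)
    (c₁ c₂ a : ℝ) : Prop where
  injective : Function.Injective C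
  compact : IsCompactOperator C
  traceClass : IsTraceClass C
  eigensystem : IsEigensystem C φ lam
  c₁_pos : 0 < c₁
  c₁_le_c₂ : c₁ ≤ c₂
  one_lt_a : 1 < a
  decay : ∀ k : ℕ, c₁ * ((k : ℝ) + 1) ^ (-a) ≤ lam k ∧ lam k ≤ c₂ * ((k : ℝ) + 1) ^ (-a)

end FAR

/-!
The estimator is compared with `Ψ` through `R = (Ĉ₀ + α)⁻¹`, of norm at most `α⁻¹`:
`Ψ̂ - Ψ = (Ĉ₁ - Ψ Ĉ₀) R - α F C₀^β R`. If `G = α C₀^β (C₀ + α)⁻¹`, then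
`α C₀^β R = G + G (C₀ - Ĉ₀) R`, and `‖G‖ ≤ K α ^ min β 1` because the Tikhonov filter has
qualification one (`exists_bias_operator`). Hence (`hsNorm_tikhonov_sub_le`) everything follows from
`‖Ĉ₁ - Ψ Ĉ₀‖_HS = O_P(n ^ (-1/2))` and `‖Ĉ₀ - C₀‖ = O_P(n ^ (-1/2))`, the choice of `α` balancing
`n ^ (-1/2) / α` against `α ^ min β 1`.

Both rates are read off from the autoregression itself. Up to terms of order one,
`(n - 1) (Ĉ₁ - Ψ Ĉ₀)` is `N = ∑ ε_{t+1} ⊗ X_t` (`smul_sampleC1_sub_eq`). The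
centred sum `A = ∑ (X_t ⊗ X_t - C₀)` satisfies, up to boundary terms,
`A - Ψ A Ψ* = N Ψ* + Ψ N* + ∑ (ε_t ⊗ ε_t - E ε_t ⊗ ε_t)`, and `A ↦ Ψ A Ψ*` is a contraction, so `A` is
bounded by the right hand side (`norm_sum_rankOne_sub_le`); likewise `(1 - Ψ) ∑ X_t` is `∑ ε_t` up to
boundary terms. The three sums on the right have martingale differences as terms, since `X_t` is a
function of the innovations up to time `t` (`IsStationaryFAR1.aestronglyMeasurable_inner`), of which
`ε_{t+1}` is independent. So their terms are orthogonal, and the second moments of their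
Hilbert–Schmidt norms, computed entrywise in the basis `φ`, are of order `n`; Markov's inequality and
a calculus of stochastic boundedness (`IsBigOInProb`) finish the proof.
-/

namespace FAR

set_option linter.unusedSectionVars false

open InnerProductSpace (rankOne)
open ContinuousLinearMap (adjoint)

/-! ### The Hilbert–Schmidt norm -/

section HilbertSchmidt

variable {H : Type*} [NormedAddCommGroup H] [InnerProductSpace ℝ H] [CompleteSpace H]

theorem hsNorm_sq {ι : Type*} (b : HilbertBasis ι ℝ H) (A : H →L[ℝ] H) :
    hsNorm A ^ 2 = ∑' i, ‖A (b i)‖ₑ ^ 2 := by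
  rw [hsNorm_eq b, ← ENNReal.rpow_natCast, ← ENNReal.rpow_mul]
  norm_num

theorem hsNorm_sq_eq_tsum_entries {ι : Type*} (b : HilbertBasis ι ℝ H) (A : H →L[ℝ] H) :
    hsNorm A ^ 2 = ∑' i, ∑' j, ‖inner ℝ (A (b i)) (b j)‖ₑ ^ 2 := by
  simp only [hsNorm_sq b, parseval_enorm]

theorem hsNorm_adjoint (A : H →L[ℝ] H) : hsNorm (adjoint A) = hsNorm A := by
  obtain ⟨w, b, -⟩ := exists_hilbertBasis ℝ H
  rw [hsNorm_eq b, hsNorm_eq b]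
  congr 1
  exact (hsSqAlong_adjoint b b A).symm

theorem hsNorm_neg (A : H →L[ℝ] H) : hsNorm (-A) = hsNorm A := by
  simp [hsNorm, hsSqAlong]

theorem hsNorm_add_le (A B : H →L[ℝ] H) : hsNorm (A + B) ≤ hsNorm A + hsNorm B := by
  obtain ⟨w, b, -⟩ := exists_hilbertBasis ℝ H
  rw [← ENNReal.pow_le_pow_left_iff two_ne_zero, hsNorm_sq b]
  refine ENNReal.summable.tsum_le_of_sum_le fun s => ?_
  have hfin : ∀ T : H →L[ℝ] H, (∑ i ∈ s, ‖T (b i)‖ₑ ^ (2 : ℝ)) ^ (1 / 2 : ℝ) ≤ hsNorm T := fun T => by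
    rw [hsNorm_eq b]
    gcongr
    simp only [ENNReal.rpow_ofNat]
    exact ENNReal.sum_le_tsum s
  have h := ENNReal.Lp_add_le s (fun i => ‖A (b i)‖ₑ) (fun i => ‖B (b i)‖ₑ) (p := 2) (by norm_num)
  calc ∑ i ∈ s, ‖(A + B) (b i)‖ₑ ^ 2
      ≤ ∑ i ∈ s, (‖A (b i)‖ₑ + ‖B (b i)‖ₑ) ^ (2 : ℝ) := by
        simp only [ENNReal.rpow_ofNat]
        gcongr
        exact enorm_add_le _ _
    _ = ((∑ i ∈ s, (‖A (b i)‖ₑ + ‖B (b i)‖ₑ) ^ (2 : ℝ)) ^ (1 / 2 : ℝ)) ^ 2 := by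
        rw [← ENNReal.rpow_natCast, ← ENNReal.rpow_mul]
        norm_num
    _ ≤ _ := by
        gcongr
        exact h.trans (add_le_add (hfin A) (hfin B))

theorem hsNorm_sub_le (A B : H →L[ℝ] H) : hsNorm (A - B) ≤ hsNorm A + hsNorm B := by
  rw [sub_eq_add_neg, ← hsNorm_neg B]
  exact hsNorm_add_le _ _

theorem hsNorm_comp_le (G A : H →L[ℝ] H) : hsNorm (G ∘L A) ≤ ‖G‖ₑ * hsNorm A := by
  obtain ⟨w, b, -⟩ := exists_hilbertBasis ℝ H
  rw [← ENNReal.pow_le_pow_left_iff two_ne_zero, mul_pow, hsNorm_sq b,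
    hsNorm_sq b, ← ENNReal.tsum_mul_left]
  refine ENNReal.tsum_le_tsum fun i => ?_
  rw [← mul_pow]
  gcongr
  exact G.le_opENorm _

/-- Right composition; reduced to left composition by passing to adjoints. -/
theorem hsNorm_comp_le' (A G : H →L[ℝ] H) : hsNorm (A ∘L G) ≤ hsNorm A * ‖G‖ₑ := by
  rw [← hsNorm_adjoint, ContinuousLinearMap.adjoint_comp, mul_comm, ← hsNorm_adjoint A]
  refine (hsNorm_comp_le _ _).trans_eq ?_
  congr 1
  exact ContinuousLinearMap.adjoint.enorm_map G

theorem hsNorm_smul (c : ℝ) (A : H →L[ℝ] H) : hsNorm (c • A) ≤ ‖c‖ₑ * hsNorm A := by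
  obtain ⟨w, b, -⟩ := exists_hilbertBasis ℝ H
  rw [← ENNReal.pow_le_pow_left_iff two_ne_zero, mul_pow, hsNorm_sq b,
    hsNorm_sq b, ← ENNReal.tsum_mul_left]
  refine ENNReal.tsum_le_tsum fun i => ?_
  simp [enorm_smul, mul_pow]

theorem hsNorm_rankOne (u v : H) : hsNorm (rankOne ℝ u v) = ‖u‖ₑ * ‖v‖ₑ := by
  obtain ⟨w, b, -⟩ := exists_hilbertBasis ℝ H
  rw [← (ENNReal.pow_right_strictMono two_ne_zero).injective.eq_iff, mul_pow, hsNorm_sq b]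
  simp only [InnerProductSpace.rankOne_apply, enorm_smul, mul_pow]
  rw [ENNReal.tsum_mul_right, parseval_enorm, mul_comm]

theorem enorm_le_hsNorm (A : H →L[ℝ] H) : ‖A‖ₑ ≤ hsNorm A := by
  obtain ⟨w, b, -⟩ := exists_hilbertBasis ℝ H
  by_cases hA : hsNorm A = ∞
  · simp [hA]
  rw [← ENNReal.ofReal_toReal hA, ← ofReal_norm]
  refine ENNReal.ofReal_le_ofReal (A.opNorm_le_bound ENNReal.toReal_nonneg fun x => ?_)
  have h : ‖A x‖ₑ ^ 2 ≤ (hsNorm A * ‖x‖ₑ) ^ 2 := by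
    rw [← parseval_enorm b, mul_pow, ← hsNorm_adjoint, hsNorm_sq b, ← ENNReal.tsum_mul_right]
    refine ENNReal.tsum_le_tsum fun i => ?_
    rw [← mul_pow, ← ContinuousLinearMap.adjoint_inner_right, mul_comm]
    gcongr
    exact ENNReal.coe_le_coe.2 (nnnorm_inner_le_nnnorm (𝕜 := ℝ) _ _)
  rw [ENNReal.pow_le_pow_left_iff two_ne_zero] at h
  have := ENNReal.toReal_mono (ENNReal.mul_ne_top hA (by simp)) h
  simpa using this

end HilbertSchmidt

/-! ### Diagonal operators and the regularisation bias -/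

section Spectral

variable {H : Type*} [NormedAddCommGroup H] [InnerProductSpace ℝ H] [CompleteSpace H]

theorem norm_spectralPow_one_le (φ : HilbertBasis ℕ ℝ H) (w : ℕ → ℝ) {δ : ℝ} (hδ : 0 ≤ δ)
    (hw : ∀ k, |w k| ≤ δ) (h : Tendsto w atTop (𝓝 0)) : ‖spectralPow φ w 1‖ ≤ δ := by
  have hs := (summable_diag φ w h).hasSum.norm
  simp only [spectralPow, Real.rpow_one]
  exact le_of_tendsto' hs fun s => norm_diag_le φ w s δ hδ fun k _ => hw k

theorem ext_hilbertBasis {ι : Type*} (b : HilbertBasis ι ℝ H) {A B : H →L[ℝ] H}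
    (h : ∀ i, A (b i) = B (b i)) : A = B := by
  refine ContinuousLinearMap.ext_on (s := Set.range b) ?_ ?_
  · rw [Submodule.dense_iff_topologicalClosure_eq_top]
    exact b.dense_span
  · rintro _ ⟨i, rfl⟩
    exact h i

/-- The Tikhonov filter has qualification one: the bound is available only for exponents `g ≤ 1`, which
is where `min β 1` comes from. -/
theorem tikhonov_filter_le {α l g : ℝ} (hα : 0 < α) (hl : 0 < l) (hg0 : 0 ≤ g) (hg1 : g ≤ 1) :
    α * l ^ g / (l + α) ≤ α ^ g := by
  rw [div_le_iff₀ (by positivity)]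
  have h := Real.geom_mean_le_arith_mean2_weighted hg0 (sub_nonneg.2 hg1) hl.le hα.le (by ring)
  have h1 : α * l ^ g = α ^ g * (l ^ g * α ^ (1 - g)) := by
    nth_rewrite 1 [← Real.rpow_one α]
    rw [show (1 : ℝ) = g + (1 - g) by ring, Real.rpow_add hα]
    ring_nf
  rw [h1]
  gcongr
  refine h.trans ?_
  nlinarith

/-- `G = α C^β (C + α)⁻¹`, built in the eigenbasis so that no inverse of `C + α` is needed. Powers of
`C` beyond the qualification are absorbed in the constant `c ^ (β - min β 1)`. -/
theorem exists_bias_operator {C : H →L[ℝ] H} {φ : HilbertBasis ℕ ℝ H} {lam : ℕ → ℝ}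
    (hC : ∀ k, C (φ k) = lam k • φ k) (hpos : ∀ k, 0 < lam k) {c : ℝ} (hc : ∀ k, lam k ≤ c)
    (hlim : Tendsto lam atTop (𝓝 0)) {β : ℝ} (hβ : 0 < β) {α : ℝ} (hα : 0 < α) :
    ∃ G : H →L[ℝ] H, ‖G‖ ≤ c ^ (β - min β 1) * α ^ (min β 1) ∧
      G ∘L (C + α • ContinuousLinearMap.id ℝ H) = α • spectralPow φ lam β := by
  have hc0 : 0 < c := (hpos 0).trans_le (hc 0)
  have hw : Tendsto (fun k => α * lam k ^ β / (lam k + α)) atTop (𝓝 0) := by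
    have h1 := hlim.rpow_const (p := β) (Or.inr hβ.le)
    rw [Real.zero_rpow hβ.ne'] at h1
    have h2 := (h1.const_mul α).div (hlim.add_const α) (by simpa using hα.ne')
    simpa [Pi.div_def] using h2
  -- `spectralPow φ w 1` is the diagonal operator with entries `w`.
  refine ⟨spectralPow φ (fun k => α * lam k ^ β / (lam k + α)) 1,
    norm_spectralPow_one_le φ _ (by positivity) (fun k => ?_) hw, ext_hilbertBasis φ fun k => ?_⟩
  · have hk := hpos k
    have hg : 0 ≤ min β 1 := le_min hβ.le zero_le_one
    rw [abs_of_nonneg (by positivity)]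
    have h1 : lam k ^ β = lam k ^ (β - min β 1) * lam k ^ (min β 1) := by
      rw [← Real.rpow_add hk]
      ring_nf
    calc α * lam k ^ β / (lam k + α)
        = lam k ^ (β - min β 1) * (α * lam k ^ (min β 1) / (lam k + α)) := by rw [h1]; ring
      _ ≤ _ := mul_le_mul
          (Real.rpow_le_rpow hk.le (hc k) (sub_nonneg.2 (min_le_left _ _)))
          (tikhonov_filter_le hα hk hg (min_le_right _ _)) (by positivity) (by positivity)
  · have hk : lam k + α ≠ 0 := (add_pos (hpos k) hα).ne'
    have h1 : (C + α • ContinuousLinearMap.id ℝ H) (φ k) = (lam k + α) • φ k := by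
      simp [hC, add_smul]
    rw [ContinuousLinearMap.comp_apply, h1, map_smul, spectralPow_apply φ _ 1 one_pos hw,
      smul_apply, spectralPow_apply φ lam β hβ hlim, Real.rpow_one, smul_smul,
      smul_smul, mul_div_cancel₀ _ hk]

end Spectral

/-! ### Error decomposition of the Tikhonov estimator -/

section Tikhonov

variable {H : Type*} [NormedAddCommGroup H] [InnerProductSpace ℝ H] [CompleteSpace H]

theorem inner_sampleC0_nonneg (n : ℕ) (x : ℤ → H) (y : H) : 0 ≤ inner ℝ (sampleC0 n x y) y := by
  simp only [sampleC0, smul_apply, sum_apply,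
    InnerProductSpace.rankOne_apply, real_inner_smul_left, sum_inner]
  exact mul_nonneg (by positivity) (Finset.sum_nonneg fun t _ => mul_self_nonneg _)

theorem norm_inverse_sampleC0_add_le (n : ℕ) {α : ℝ} (hα : 0 < α) (x : ℤ → H) :
    ‖Ring.inverse (sampleC0 n x + α • ContinuousLinearMap.id ℝ H)‖ ≤ α⁻¹ := by
  set B := sampleC0 n x + α • ContinuousLinearMap.id ℝ H with hB
  refine ContinuousLinearMap.opNorm_le_bound _ (by positivity) fun z => ?_
  set y := Ring.inverse B z with hy
  have hz : B y = z := by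
    have := Ring.mul_inverse_cancel B (isUnit_sampleC0_add n hα x)
    simpa using congrArg (fun T : H →L[ℝ] H => T z) this
  have h1 : α * ‖y‖ ^ 2 ≤ ‖z‖ * ‖y‖ := by
    calc α * ‖y‖ ^ 2 ≤ inner ℝ (B y) y := by
          simp only [hB, add_apply, inner_add_left,
            smul_apply, real_inner_smul_left, ContinuousLinearMap.id_apply,
            real_inner_self_eq_norm_sq]
          linarith [inner_sampleC0_nonneg n x y]
      _ ≤ _ := by rw [hz]; exact real_inner_le_norm _ _
  rw [← div_eq_inv_mul, le_div_iff₀ hα]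
  by_contra! hlt
  have hy0 : 0 < ‖y‖ := by
    by_contra! h
    have : ‖y‖ = 0 := le_antisymm h (norm_nonneg _)
    rw [this] at hlt
    linarith [norm_nonneg z]
  nlinarith

/-- With `R = (Ĉ₀ + α)⁻¹` one has `Ψ̂ - Ψ = (Ĉ₁ - Ψ Ĉ₀) R - α F C₀^β R`, and
`α C₀^β R = G + G (C₀ - Ĉ₀) R` for the operator `G` of `exists_bias_operator`: a stochastic error
amplified by `α⁻¹`, and a bias. -/
theorem hsNorm_tikhonov_sub_le {n : ℕ} {α : ℝ} (hα : 0 < α) {x : ℤ → H} {Ψ F C S G : H →L[ℝ] H}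
    (hΨ : Ψ = F ∘L S) (hG : G ∘L (C + α • ContinuousLinearMap.id ℝ H) = α • S) :
    hsNorm (tikhonov n α x - Ψ) ≤ hsNorm (sampleC1 n x - Ψ ∘L sampleC0 n x) * ENNReal.ofReal α⁻¹
      + hsNorm F * (‖G‖ₑ * (1 + ‖sampleC0 n x - C‖ₑ * ENNReal.ofReal α⁻¹)) := by
  have hu := isUnit_sampleC0_add n hα x
  set R := Ring.inverse (sampleC0 n x + α • ContinuousLinearMap.id ℝ H) with hR
  have hR1 : ‖R‖ₑ ≤ ENNReal.ofReal α⁻¹ := by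
    rw [← ofReal_norm]
    exact ENNReal.ofReal_le_ofReal (norm_inverse_sampleC0_add_le n hα x)
  have hBR : ∀ z, sampleC0 n x (R z) + α • R z = z := fun z => by
    have := Ring.mul_inverse_cancel _ hu
    simpa using congrArg (fun T : H →L[ℝ] H => T z) this
  have hGz : ∀ z, α • S z = G (C z) + α • G z := fun z => by
    have := congrArg (fun T : H →L[ℝ] H => T z) hG
    simpa using this.symm
  have key : tikhonov n α x - Ψ = (sampleC1 n x - Ψ ∘L sampleC0 n x) ∘L R
      - F ∘L (G - G ∘L ((sampleC0 n x - C) ∘L R)) := by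
    ext z : 1
    have e1 : Ψ z = Ψ (sampleC0 n x (R z)) + F (α • S (R z)) := by
      nth_rewrite 1 [← hBR z]
      rw [map_add, map_smul, map_smul, hΨ]
      rfl
    have e2 : G z = G (sampleC0 n x (R z)) + α • G (R z) := by
      nth_rewrite 1 [← hBR z]
      rw [map_add, map_smul]
    have e3 : G z - G ((sampleC0 n x - C) (R z)) = α • S (R z) := by
      rw [hGz, e2, sub_apply, map_sub]
      abel
    simp only [tikhonov, sub_apply, ContinuousLinearMap.comp_apply] at e3 ⊢
    rw [e3, e1]
    abel
  rw [key]
  refine (hsNorm_sub_le _ _).trans (add_le_add ?_ ?_)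
  · exact (hsNorm_comp_le' _ _).trans (by gcongr)
  · refine (hsNorm_comp_le' _ _).trans ?_
    gcongr
    refine (enorm_sub_le).trans ?_
    rw [mul_add, mul_one]
    gcongr
    refine (ContinuousLinearMap.opENorm_comp_le _ _).trans ?_
    gcongr
    exact (ContinuousLinearMap.opENorm_comp_le _ _).trans (by gcongr)

end Tikhonov

/-! ### Calculus of stochastic boundedness -/

namespace IsBigOInProb

variable {Ω : Type*} [MeasurableSpace Ω] {P : Measure Ω} {Y Z : ℕ → Ω → ℝ≥0∞} {r s : ℕ → ℝ}

theorem mono (hZ : IsBigOInProb P Z r) (h : ∀ᶠ n in atTop, ∀ᵐ ω ∂P, Y n ω ≤ Z n ω) :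
    IsBigOInProb P Y r := by
  intro η hη
  obtain ⟨M, hM, hb⟩ := hZ η hη
  refine ⟨M, hM, ?_⟩
  filter_upwards [hb, h] with n hn hle
  refine (measure_mono_ae ?_).trans hn
  filter_upwards [hle] with ω hω hlt
  exact lt_of_lt_of_le (α := ℝ≥0∞) hlt hω

theorem mono_rate {K : ℝ} (hY : IsBigOInProb P Y r) (hK : 0 < K)
    (h : ∀ᶠ n in atTop, r n ≤ K * s n) : IsBigOInProb P Y s := by
  intro η hη
  obtain ⟨M, hM, hb⟩ := hY η hη
  refine ⟨M * K, by positivity, ?_⟩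
  filter_upwards [hb, h] with n hn hle
  refine (measure_mono fun ω hω => ?_).trans hn
  refine lt_of_le_of_lt (ENNReal.ofReal_le_ofReal ?_) (show _ < _ from hω)
  rw [mul_assoc]
  gcongr

theorem add (hr : ∀ n, 0 ≤ r n) (hY : IsBigOInProb P Y r) (hZ : IsBigOInProb P Z r) :
    IsBigOInProb P (fun n ω => Y n ω + Z n ω) r := by
  intro η hη
  obtain ⟨M, hM, hb⟩ := hY (η / 2) (by positivity)
  obtain ⟨N, hN, hc⟩ := hZ (η / 2) (by positivity)
  refine ⟨M + N, by positivity, ?_⟩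
  filter_upwards [hb, hc] with n h1 h2
  calc P {ω | ENNReal.ofReal ((M + N) * r n) < Y n ω + Z n ω}
      ≤ P ({ω | ENNReal.ofReal (M * r n) < Y n ω} ∪ {ω | ENNReal.ofReal (N * r n) < Z n ω}) := by
        refine measure_mono fun ω hω => ?_
        by_contra hcon
        simp only [Set.mem_union, Set.mem_ofPred_eq, not_or, not_lt] at hcon hω
        rw [add_mul, ENNReal.ofReal_add (by have := hr n; positivity)
          (by have := hr n; positivity)] at hω
        exact absurd hω (not_lt.2 (add_le_add hcon.1 hcon.2))
    _ ≤ ENNReal.ofReal (η / 2) + ENNReal.ofReal (η / 2) :=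
        (measure_union_le _ _).trans (add_le_add h1 h2)
    _ = ENNReal.ofReal η := by
        rw [← ENNReal.ofReal_add (by positivity) (by positivity), add_halves]

theorem mul (hr : ∀ n, 0 ≤ r n) (hY : IsBigOInProb P Y r)
    (hZ : IsBigOInProb P Z s) :
    IsBigOInProb P (fun n ω => Y n ω * Z n ω) (fun n => r n * s n) := by
  intro η hη
  obtain ⟨M, hM, hb⟩ := hY (η / 2) (by positivity)
  obtain ⟨N, hN, hc⟩ := hZ (η / 2) (by positivity)
  refine ⟨M * N, by positivity, ?_⟩
  filter_upwards [hb, hc] with n h1 h2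
  calc P {ω | ENNReal.ofReal (M * N * (r n * s n)) < Y n ω * Z n ω}
      ≤ P ({ω | ENNReal.ofReal (M * r n) < Y n ω} ∪ {ω | ENNReal.ofReal (N * s n) < Z n ω}) := by
        refine measure_mono fun ω hω => ?_
        by_contra hcon
        simp only [Set.mem_union, Set.mem_ofPred_eq, not_or, not_lt] at hcon hω
        rw [mul_mul_mul_comm, ENNReal.ofReal_mul (by have := hr n; positivity)] at hω
        exact absurd hω (not_lt.2 (mul_le_mul' hcon.1 hcon.2))
    _ ≤ ENNReal.ofReal (η / 2) + ENNReal.ofReal (η / 2) :=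
        (measure_union_le _ _).trans (add_le_add h1 h2)
    _ = ENNReal.ofReal η := by
        rw [← ENNReal.ofReal_add (by positivity) (by positivity), add_halves]

theorem of_le {K : ℝ} (hK : 0 < K) (h : ∀ᶠ n in atTop, ∀ ω, Y n ω ≤ ENNReal.ofReal (K * r n)) :
    IsBigOInProb P Y r := by
  intro η hη
  refine ⟨K, hK, ?_⟩
  filter_upwards [h] with n hn
  have : {ω | ENNReal.ofReal (K * r n) < Y n ω} = ∅ := by
    ext ω
    simpa using hn ω
  simp [this]

theorem const {c : ℝ≥0∞} (hc : c ≠ ∞) : IsBigOInProb P (fun _ _ => c) (fun _ => 1) := by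
  refine of_le (K := c.toReal + 1) (by positivity) (Eventually.of_forall fun n ω => ?_)
  rw [mul_one]
  exact (ENNReal.ofReal_toReal hc).symm.le.trans (ENNReal.ofReal_le_ofReal (by linarith))

theorem const_mul {c : ℝ≥0∞} (hc : c ≠ ∞) (hY : IsBigOInProb P Y r) :
    IsBigOInProb P (fun n ω => c * Y n ω) r := by
  simpa using mul (fun _ => zero_le_one) (const (P := P) hc) hY

/-- Markov's inequality for the square. -/
theorem of_lintegral_sq {K : ℝ≥0∞} (hK : K ≠ ∞) (hr : ∀ᶠ n in atTop, 0 < r n)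
    (hmeas : ∀ n, AEMeasurable (fun ω => Y n ω ^ 2) P)
    (h : ∀ᶠ n in atTop, ∫⁻ ω, Y n ω ^ 2 ∂P ≤ K * ENNReal.ofReal (r n) ^ 2) :
    IsBigOInProb P Y r := by
  intro η hη
  set k : ℝ := K.toReal
  have hk : 0 ≤ k := ENNReal.toReal_nonneg
  refine ⟨(k + 1) / η + 1, by positivity, ?_⟩
  filter_upwards [hr, h] with n hn hle
  have hM : 0 < (k + 1) / η + 1 := by positivity
  set T : ℝ≥0∞ := ENNReal.ofReal (((k + 1) / η + 1) * r n) with hT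
  have hT0 : T ^ 2 ≠ 0 := by
    simp only [hT, ne_eq, pow_eq_zero_iff two_ne_zero, ENNReal.ofReal_eq_zero, not_le]
    positivity
  have hTt : T ^ 2 ≠ ∞ := by simp [hT]
  have hMk : T ^ 2 * P {ω | T < Y n ω} ≤ T ^ 2 * ENNReal.ofReal η := by
    calc T ^ 2 * P {ω | T < Y n ω} ≤ T ^ 2 * P {ω | T ^ 2 ≤ Y n ω ^ 2} := by
          gcongr with ω
          intro hω
          gcongr
      _ ≤ ∫⁻ ω, Y n ω ^ 2 ∂P := mul_meas_ge_le_lintegral₀ (hmeas n) _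
      _ ≤ K * ENNReal.ofReal (r n) ^ 2 := hle
      _ ≤ T ^ 2 * ENNReal.ofReal η := by
          rw [← ENNReal.ofReal_toReal hK, hT, ← ENNReal.ofReal_pow hn.le,
            ← ENNReal.ofReal_mul hk, ← ENNReal.ofReal_pow (by positivity),
            ← ENNReal.ofReal_mul (by positivity)]
          refine ENNReal.ofReal_le_ofReal ?_
          have h1 : k ≤ ((k + 1) / η + 1) ^ 2 * η := by
            have e : (k + 1) / η * η = k + 1 := by field_simp
            have : 0 ≤ (k + 1) / η := by positivity
            have : 0 ≤ (k + 1) / η * ((k + 1) / η) * η := by positivity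
            nlinarith
          calc k * r n ^ 2 ≤ ((k + 1) / η + 1) ^ 2 * η * r n ^ 2 := by gcongr
            _ = _ := by ring
  exact (ENNReal.mul_le_mul_iff_right hT0 hTt).1 hMk

end IsBigOInProb

/-! ### Pathwise bounds along the autoregression -/

section Pathwise

variable {H : Type*} [NormedAddCommGroup H] [InnerProductSpace ℝ H] [CompleteSpace H]

theorem sum_Icc_one_eq {M : Type*} [AddCommMonoid M] (f : ℤ → M) (n : ℕ) :
    ∑ t ∈ Finset.Icc 1 n, f t = ∑ k ∈ Finset.range n, f (k + 1) := by
  induction n with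
  | zero => simp
  | succ n ih => rw [Finset.sum_Icc_succ_top (by omega), ih, Finset.sum_range_succ]; push_cast; rfl

theorem sum_range_eq_add_sub {M : Type*} [AddCommGroup M] (f : ℤ → M) (n : ℕ) :
    ∑ k ∈ Finset.range n, f k = ∑ k ∈ Finset.range n, f (k + 1) + f 0 - f n := by
  have h := Finset.sum_range_sub (fun k : ℕ => f k) n
  rw [Finset.sum_sub_distrib] at h
  push_cast at h
  rw [add_sub_assoc, ← sub_eq_iff_eq_add', ← neg_sub, h, neg_sub]

variable {Ψ : H →L[ℝ] H} {x e : ℤ → H}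

/-- Summing the recursion expresses `(1 - Ψ) ∑ x` by the sum of the innovations and boundary terms. -/
theorem norm_sum_le_of_recursion (hx : ∀ t, x t = Ψ (x (t - 1)) + e t) (hΨ : ‖Ψ‖ < 1) (n : ℕ) :
    ‖∑ k ∈ Finset.range n, x (k + 1)‖ ≤
      (1 - ‖Ψ‖)⁻¹ * (‖x 0‖ + ‖x n‖ + ‖∑ k ∈ Finset.range n, e (k + 1)‖) := by
  set V := ∑ k ∈ Finset.range n, x (k + 1) with hV
  set S := ∑ k ∈ Finset.range n, e (k + 1)
  have h1 : V = Ψ V + Ψ (x 0) - Ψ (x n) + S := by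
    calc V = Ψ (∑ k ∈ Finset.range n, x k) + S := by
          rw [map_sum, ← Finset.sum_add_distrib]
          exact Finset.sum_congr rfl fun k _ => by rw [hx, add_sub_cancel_right]
      _ = _ := by rw [sum_range_eq_add_sub, map_sub, map_add]
  have h2 : ‖V‖ ≤ ‖Ψ‖ * ‖V‖ + ‖x 0‖ + ‖x n‖ + ‖S‖ := by
    have hb : ∀ y, ‖Ψ y‖ ≤ ‖y‖ := fun y =>
      (Ψ.le_opNorm y).trans (mul_le_of_le_one_left (norm_nonneg _) hΨ.le)
    calc ‖V‖ = ‖Ψ V + Ψ (x 0) - Ψ (x n) + S‖ := by rw [← h1]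
      _ ≤ ‖Ψ V‖ + ‖Ψ (x 0)‖ + ‖Ψ (x n)‖ + ‖S‖ := by
          refine (norm_add_le _ _).trans ?_
          gcongr
          refine (norm_sub_le _ _).trans ?_
          gcongr
          exact norm_add_le _ _
      _ ≤ _ := by gcongr; exacts [Ψ.le_opNorm V, hb _, hb _]
  rw [le_inv_mul_iff₀ (by linarith)]
  linarith

/-- The map `A ↦ Ψ A Ψ*` is a contraction, and the centred sum `A` of `x ⊗ x` is a fixed point of
it up to boundary terms and sums of martingale differences. -/
theorem norm_sum_rankOne_sub_le (hx : ∀ t, x t = Ψ (x (t - 1)) + e t) (hΨ : ‖Ψ‖ < 1)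
    (C : H →L[ℝ] H) (n : ℕ) :
    ‖∑ k ∈ Finset.range n, (rankOne ℝ (x (k + 1)) (x (k + 1)) - C)‖ ≤
      (1 - ‖Ψ‖)⁻¹ * (‖x 0‖ ^ 2 + ‖x n‖ ^ 2
        + 2 * ‖∑ k ∈ Finset.range n, rankOne ℝ (e (k + 1)) (x k)‖
        + ‖∑ k ∈ Finset.range n,
            (rankOne ℝ (e (k + 1)) (e (k + 1)) - (C - Ψ ∘L C ∘L adjoint Ψ))‖) := by
  set A := ∑ k ∈ Finset.range n, (rankOne ℝ (x (k + 1)) (x (k + 1)) - C)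
  set N := ∑ k ∈ Finset.range n, rankOne ℝ (e (k + 1)) (x k)
  set M := ∑ k ∈ Finset.range n,
    (rankOne ℝ (e (k + 1)) (e (k + 1)) - (C - Ψ ∘L C ∘L adjoint Ψ))
  set B₀ := rankOne ℝ (x 0) (x 0)
  set B₁ := rankOne ℝ (x n) (x n)
  have hb : ∀ T : H →L[ℝ] H, ‖Ψ ∘L T ∘L adjoint Ψ‖ ≤ ‖Ψ‖ * ‖T‖ := fun T => by
    have h1 : ‖adjoint Ψ‖ = ‖Ψ‖ := ContinuousLinearMap.adjoint.norm_map Ψ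
    calc ‖Ψ ∘L T ∘L adjoint Ψ‖ ≤ ‖Ψ‖ * (‖T‖ * ‖adjoint Ψ‖) :=
          (ContinuousLinearMap.opNorm_comp_le _ _).trans
            (by gcongr; exact ContinuousLinearMap.opNorm_comp_le _ _)
      _ ≤ ‖Ψ‖ * (‖T‖ * 1) := by rw [h1]; gcongr
      _ = _ := by rw [mul_one]
  have hb' : ∀ T : H →L[ℝ] H, ‖Ψ ∘L T ∘L adjoint Ψ‖ ≤ ‖T‖ := fun T =>
    (hb T).trans (mul_le_of_le_one_left (norm_nonneg _) hΨ.le)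
  have hA' : ∑ k ∈ Finset.range n, (rankOne ℝ (x k) (x k) - C) = A + B₀ - B₁ := by
    rw [sum_range_eq_add_sub (fun t => rankOne ℝ (x t) (x t) - C)]
    simp only [A, B₀, B₁]
    abel
  have h1 : A = Ψ ∘L (A + B₀ - B₁) ∘L adjoint Ψ + N ∘L adjoint Ψ + adjoint (N ∘L adjoint Ψ) + M := by
    rw [← hA']
    simp only [A, N, M]
    ext z : 1
    simp only [sum_apply, add_apply, ContinuousLinearMap.comp_apply, map_sum,
      ContinuousLinearMap.adjoint_comp, ContinuousLinearMap.adjoint_adjoint,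
      InnerProductSpace.adjoint_rankOne]
    rw [← Finset.sum_add_distrib, ← Finset.sum_add_distrib, ← Finset.sum_add_distrib]
    refine Finset.sum_congr rfl fun k _ => ?_
    have hk : x (k + 1) = Ψ (x k) + e (k + 1) := by rw [hx, add_sub_cancel_right]
    simp only [sub_apply, InnerProductSpace.rankOne_apply, hk, inner_add_left, map_sub, map_smul,
      ContinuousLinearMap.adjoint_inner_right, ContinuousLinearMap.comp_apply, smul_add, add_smul]
    abel
  have hN : ‖N ∘L adjoint Ψ‖ ≤ ‖N‖ := by
    refine (ContinuousLinearMap.opNorm_comp_le _ _).trans ?_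
    have h1 : ‖adjoint Ψ‖ = ‖Ψ‖ := ContinuousLinearMap.adjoint.norm_map Ψ
    rw [h1]
    exact mul_le_of_le_one_right (norm_nonneg _) hΨ.le
  have hN' : ‖adjoint (N ∘L adjoint Ψ)‖ ≤ ‖N‖ :=
    (ContinuousLinearMap.adjoint.norm_map _).le.trans hN
  have hB₀ : ‖B₀‖ = ‖x 0‖ ^ 2 := by rw [InnerProductSpace.norm_rankOne, sq]
  have hB₁ : ‖B₁‖ = ‖x n‖ ^ 2 := by rw [InnerProductSpace.norm_rankOne, sq]
  have h2 : ‖A‖ ≤ ‖Ψ‖ * ‖A‖ + ‖B₀‖ + ‖B₁‖ + ‖N‖ + ‖N‖ + ‖M‖ := by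
    calc ‖A‖ = ‖Ψ ∘L A ∘L adjoint Ψ + Ψ ∘L B₀ ∘L adjoint Ψ - Ψ ∘L B₁ ∘L adjoint Ψ
          + N ∘L adjoint Ψ + adjoint (N ∘L adjoint Ψ) + M‖ := by
          nth_rewrite 1 [h1]
          simp only [ContinuousLinearMap.sub_comp, ContinuousLinearMap.add_comp,
            ContinuousLinearMap.comp_sub, ContinuousLinearMap.comp_add]
      _ ≤ ‖Ψ ∘L A ∘L adjoint Ψ‖ + ‖Ψ ∘L B₀ ∘L adjoint Ψ‖ + ‖Ψ ∘L B₁ ∘L adjoint Ψ‖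
          + ‖N ∘L adjoint Ψ‖ + ‖adjoint (N ∘L adjoint Ψ)‖ + ‖M‖ := by
          refine (norm_add_le _ _).trans ?_
          gcongr
          refine (norm_add_le _ _).trans ?_
          gcongr
          refine (norm_add_le _ _).trans ?_
          gcongr
          refine (norm_sub_le _ _).trans ?_
          gcongr
          exact norm_add_le _ _
      _ ≤ _ := by gcongr; exacts [hb A, hb' _, hb' _]
  rw [hB₀, hB₁] at h2
  rw [le_inv_mul_iff₀ (by linarith)]
  linarith

theorem sampleC0_sub_eq {n : ℕ} (hn : n ≠ 0) (x : ℤ → H) (C : H →L[ℝ] H) :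
    sampleC0 n x - C =
      (n : ℝ)⁻¹ • ∑ k ∈ Finset.range n, (rankOne ℝ (x (k + 1)) (x (k + 1)) - C)
        - rankOne ℝ (sampleMean n x) (sampleMean n x) := by
  have hn' : (n : ℝ) ≠ 0 := by exact_mod_cast hn
  have hm : ∑ k ∈ Finset.range n, x (k + 1) = (n : ℝ) • sampleMean n x := by
    rw [sampleMean, smul_inv_smul₀ hn', sum_Icc_one_eq]
  set m := sampleMean n x with hmdef
  rw [sampleC0, ← hmdef, sum_Icc_one_eq (fun t => rankOne ℝ (x t - m) (x t - m))]
  ext z : 1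
  simp only [sub_apply, smul_apply, sum_apply, InnerProductSpace.rankOne_apply, inner_sub_left,
    sub_smul, smul_sub, Finset.sum_sub_distrib, ← Finset.smul_sum, ← Finset.sum_smul, hm]
  rw [← sum_inner, hm]
  simp only [Finset.sum_const, Finset.card_range, inner_smul_left, smul_smul]
  rw [← Nat.cast_smul_eq_nsmul ℝ, ← Nat.cast_smul_eq_nsmul ℝ]
  simp only [smul_smul, conj_trivial, inv_mul_cancel_left₀ hn', inv_mul_cancel₀ hn', one_smul]
  have hcan : ∀ a : ℝ, (n : ℝ)⁻¹ * a * n = a := fun a => by field_simp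
  simp only [hcan, ← mul_assoc]
  generalize (n : ℝ)⁻¹ • ∑ k ∈ Finset.range n, inner ℝ (x (k + 1)) z • x (k + 1) = v
  abel

/-- The part of `Ĉ₁` not explained by `Ψ Ĉ₀`: a sum of martingale differences, and terms of order
one. -/
theorem smul_sampleC1_sub_eq (hx : ∀ t, x t = Ψ (x (t - 1)) + e t) {n : ℕ} (hn : 2 ≤ n) :
    ((n : ℝ) - 1) • (sampleC1 n x - Ψ ∘L sampleC0 n x) =
      Ψ ∘L sampleC0 n x - Ψ ∘L rankOne ℝ (x n - sampleMean n x) (x n - sampleMean n x)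
        + ∑ t ∈ Finset.Ico 1 n, rankOne ℝ (e (t + 1)) (x t)
        - rankOne ℝ (∑ t ∈ Finset.Ico 1 n, e (t + 1)) (sampleMean n x)
        + rankOne ℝ (Ψ (sampleMean n x) - sampleMean n x) (sampleMean n x - x n) := by
  have hn2 : (2 : ℝ) ≤ n := by exact_mod_cast hn
  have hn' : (n : ℝ) ≠ 0 := by linarith
  have hn1 : (n : ℝ) - 1 ≠ 0 := by linarith
  have hm : ∑ t ∈ Finset.Icc 1 n, x t = (n : ℝ) • sampleMean n x := by
    rw [sampleMean, smul_inv_smul₀ hn']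
  have hc : ∑ t ∈ Finset.Icc 1 n, rankOne ℝ (x t - sampleMean n x) (x t - sampleMean n x)
      = (n : ℝ) • sampleC0 n x := by
    rw [sampleC0, smul_inv_smul₀ hn']
  set m := sampleMean n x with hmdef
  set C := sampleC0 n x
  rw [← Finset.Ico_insert_right (by omega), Finset.sum_insert (by simp), ← eq_sub_iff_add_eq'] at hm hc
  have hd : ∑ t ∈ Finset.Ico 1 n, (x t - m) = m - x n := by
    rw [Finset.sum_sub_distrib, hm, Finset.sum_const, Nat.card_Ico, ← Nat.cast_smul_eq_nsmul ℝ,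
      Nat.cast_sub (by omega), sub_smul]
    simp only [Nat.cast_one, one_smul]
    abel
  rw [smul_sub, sampleC1, ← hmdef, smul_inv_smul₀ hn1]
  have hterm : ∀ t : ℕ, rankOne ℝ (x (t + 1) - m) (x t - m) =
      Ψ ∘L rankOne ℝ (x t - m) (x t - m) + rankOne ℝ (e (t + 1)) (x t)
        - rankOne ℝ (e (t + 1)) m + rankOne ℝ (Ψ m - m) (x t - m) := fun t => by
    have hk : x (t + 1) - m = Ψ (x t - m) + e (t + 1) + (Ψ m - m) := by
      rw [hx, add_sub_cancel_right, map_sub]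
      abel
    rw [hk, InnerProductSpace.comp_rankOne, map_add, map_add, add_apply, add_apply,
      map_sub (rankOne ℝ (e (t + 1)))]
    abel
  simp only [hterm, Finset.sum_add_distrib, Finset.sum_sub_distrib]
  have hc' : ∑ t ∈ Finset.Ico 1 n, Ψ ∘L rankOne ℝ (x t - m) (x t - m)
      = (n : ℝ) • (Ψ ∘L C) - Ψ ∘L rankOne ℝ (x n - m) (x n - m) := by
    rw [← ContinuousLinearMap.comp_finsetSum, hc, ContinuousLinearMap.comp_sub,
      ContinuousLinearMap.comp_smul]
  have hS : ∑ t ∈ Finset.Ico 1 n, rankOne ℝ (e (t + 1)) m =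
      rankOne ℝ (∑ t ∈ Finset.Ico 1 n, e (t + 1)) m := by
    rw [map_sum, sum_apply]
  rw [hc', hS, ← map_sum, hd, sub_smul, one_smul]
  abel

theorem eq_sum_pow_apply_add (hx : ∀ t, x t = Ψ (x (t - 1)) + e t) (t : ℤ) (N : ℕ) :
    x t = ∑ j ∈ Finset.range N, (Ψ ^ j) (e (t - j)) + (Ψ ^ N) (x (t - N)) := by
  induction N with
  | zero => simp
  | succ N ih =>
    nth_rewrite 1 [ih]
    rw [Finset.sum_range_succ, hx (t - N), map_add, pow_succ Ψ N, mul_apply_eq_comp]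
    push_cast
    rw [sub_sub]
    abel

end Pathwise

/-! ### Orthogonality of martingale differences -/

section Orthogonality

variable {Ω : Type*} [mΩ : MeasurableSpace Ω] {P : Measure Ω} [IsProbabilityMeasure P]

theorem indepFun_of_aestronglyMeasurable {m : MeasurableSpace Ω} {f q : Ω → ℝ}
    (hf : AEStronglyMeasurable[m] f P) (h : Indep m (MeasurableSpace.comap q inferInstance) P) :
    IndepFun f q P := by
  have h1 : IndepFun (hf.mk f) q P := by
    rw [IndepFun_iff_Indep]
    exact indep_of_indep_of_le_left h hf.stronglyMeasurable_mk.measurable.comap_le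
  exact h1.congr hf.ae_eq_mk.symm ae_eq_rfl

/-- Sums of martingale differences `p t * q t` have orthogonal terms: `p t` is determined by the past
`G t`, of which the centred `q t` is independent. Second moments of `p t` and `q t` suffice, since the
two are independent. -/
theorem integral_sq_sum_mul {p q : ℕ → Ω → ℝ} {G : ℕ → MeasurableSpace Ω} (hGmono : Monotone G)
    (hp : ∀ t, AEStronglyMeasurable[G t] (p t) P) (hq : ∀ t, Measurable[G (t + 1)] (q t))
    (hpL : ∀ t, MemLp (p t) 2 P) (hqL : ∀ t, MemLp (q t) 2 P) (hq0 : ∀ t, ∫ ω, q t ω ∂P = 0)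
    (hind : ∀ t, Indep (G t) (MeasurableSpace.comap (q t) inferInstance) P) (s : Finset ℕ) :
    MemLp (fun ω => ∑ t ∈ s, p t ω * q t ω) 2 P ∧
    ∫ ω, (∑ t ∈ s, p t ω * q t ω) ^ 2 ∂P =
      ∑ t ∈ s, (∫ ω, p t ω ^ 2 ∂P) * ∫ ω, q t ω ^ 2 ∂P := by
  have hpq : ∀ t, IndepFun (fun ω => p t ω ^ 2) (fun ω => q t ω ^ 2) P := fun t =>
    (indepFun_of_aestronglyMeasurable (hp t) (hind t)).comp
      (φ := fun y : ℝ => y ^ 2) (ψ := fun y : ℝ => y ^ 2) (by fun_prop) (by fun_prop)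
  have hdL : ∀ t, MemLp (fun ω => p t ω * q t ω) 2 P := fun t => by
    refine (memLp_two_iff_integrable_sq ((hpL t).1.mul (hqL t).1)).2 ?_
    have := (hpq t).integrable_mul (hpL t).integrable_sq (hqL t).integrable_sq
    simpa [Pi.mul_def, mul_pow] using this
  have hcross : ∀ t u, t < u → ∫ ω, (p t ω * q t ω) * (p u ω * q u ω) ∂P = 0 := fun t u htu => by
    have h1 : AEStronglyMeasurable[G u] (fun ω => p t ω * q t ω * p u ω) P :=
      (((hp t).mono (hGmono htu.le)).mul
        (((hq t).mono (hGmono htu) le_rfl).stronglyMeasurable.aestronglyMeasurable)).mul (hp u)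
    have h2 := (indepFun_of_aestronglyMeasurable h1 (hind u)).integral_fun_mul_eq_mul_integral
      (((hpL t).1.mul (hqL t).1).mul (hpL u).1) (hqL u).1
    rw [hq0, mul_zero] at h2
    rw [← h2]
    congr 1
    ext ω
    ring
  have hint : ∀ t u, Integrable (fun ω => (p t ω * q t ω) * (p u ω * q u ω)) P := fun t u =>
    (hdL t).integrable_mul (hdL u)
  refine ⟨memLp_finsetSum s fun t _ => hdL t, ?_⟩
  calc ∫ ω, (∑ t ∈ s, p t ω * q t ω) ^ 2 ∂P
      = ∫ ω, ∑ t ∈ s, ∑ u ∈ s, (p t ω * q t ω) * (p u ω * q u ω) ∂P := by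
        simp only [sq, Finset.sum_mul_sum]
    _ = ∑ t ∈ s, ∑ u ∈ s, ∫ ω, (p t ω * q t ω) * (p u ω * q u ω) ∂P := by
        rw [integral_finsetSum _ fun t _ => integrable_finsetSum _ fun u _ => hint t u]
        exact Finset.sum_congr rfl fun t _ => integral_finsetSum _ fun u _ => hint t u
    _ = ∑ t ∈ s, ∫ ω, (p t ω * q t ω) * (p t ω * q t ω) ∂P := by
        refine Finset.sum_congr rfl fun t ht => Finset.sum_eq_single_of_mem t ht fun u _ hut => ?_
        rcases lt_or_gt_of_ne hut with h | h
        · rw [← hcross u t h]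
          congr 1
          ext ω
          ring
        · exact hcross t u h
    _ = _ := by
        refine Finset.sum_congr rfl fun t _ => ?_
        rw [← (hpq t).integral_fun_mul_eq_mul_integral ((hpL t).1.pow 2) ((hqL t).1.pow 2)]
        congr 1
        ext ω
        ring

theorem lintegral_enorm_sq_eq {f : Ω → ℝ} (hf : MemLp f 2 P) :
    ∫⁻ ω, ‖f ω‖ₑ ^ 2 ∂P = ENNReal.ofReal (∫ ω, f ω ^ 2 ∂P) := by
  rw [ofReal_integral_eq_lintegral_ofReal hf.integrable_sq (ae_of_all _ fun ω => sq_nonneg _)]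
  congr 1
  ext ω
  rw [← ofReal_norm, ← ENNReal.ofReal_pow (norm_nonneg _), Real.norm_eq_abs, sq_abs]

/-- `integral_sq_sum_mul` with values in `[0,∞]`. -/
theorem lintegral_enorm_sq_sum_mul {p q : ℕ → Ω → ℝ} {G : ℕ → MeasurableSpace Ω}
    (hGmono : Monotone G)
    (hp : ∀ t, AEStronglyMeasurable[G t] (p t) P) (hq : ∀ t, Measurable[G (t + 1)] (q t))
    (hpL : ∀ t, MemLp (p t) 2 P) (hqL : ∀ t, MemLp (q t) 2 P) (hq0 : ∀ t, ∫ ω, q t ω ∂P = 0)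
    (hind : ∀ t, Indep (G t) (MeasurableSpace.comap (q t) inferInstance) P) (s : Finset ℕ) :
    ∫⁻ ω, ‖∑ t ∈ s, p t ω * q t ω‖ₑ ^ 2 ∂P =
      ∑ t ∈ s, (∫⁻ ω, ‖p t ω‖ₑ ^ 2 ∂P) * ∫⁻ ω, ‖q t ω‖ₑ ^ 2 ∂P := by
  obtain ⟨h1, h2⟩ := integral_sq_sum_mul hGmono hp hq hpL hqL hq0 hind s
  rw [lintegral_enorm_sq_eq h1, h2, ENNReal.ofReal_sum_of_nonneg fun t _ =>
    mul_nonneg (integral_nonneg fun ω => sq_nonneg _) (integral_nonneg fun ω => sq_nonneg _)]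
  refine Finset.sum_congr rfl fun t _ => ?_
  rw [ENNReal.ofReal_mul (integral_nonneg fun ω => sq_nonneg _), lintegral_enorm_sq_eq (hpL t),
    lintegral_enorm_sq_eq (hqL t)]

end Orthogonality

/-! ### The innovations and the past -/

section Past

variable {Ω : Type*} [mΩ : MeasurableSpace Ω] {H : Type*} [MeasurableSpace H]

/-- The information carried by the innovations up to time `t`. -/
abbrev past (ε : ℤ → Ω → H) (t : ℤ) : MeasurableSpace Ω :=
  ⨆ s ∈ Set.Iic t, MeasurableSpace.comap (ε s) inferInstance

theorem past_mono (ε : ℤ → Ω → H) : Monotone (past ε) := fun _ _ h =>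
  biSup_mono fun _ hs => le_trans hs h

theorem measurable_past (ε : ℤ → Ω → H) {s t : ℤ} (h : s ≤ t) : Measurable[past ε t] (ε s) :=
  measurable_iff_comap_le.2
    (le_iSup₂_of_le (f := fun s (_ : s ∈ Set.Iic t) =>
      MeasurableSpace.comap (ε s) inferInstance) s h le_rfl)

theorem indep_past {P : Measure Ω} {ε : ℤ → Ω → H} (hε : ∀ t, Measurable (ε t))
    (h : iIndepFun ε P) (t : ℤ) :
    Indep (past ε t) (MeasurableSpace.comap (ε (t + 1)) inferInstance) P := by
  have h1 := indep_iSup_of_disjoint (fun s => (hε s).comap_le) h (S := Set.Iic t) (T := {t + 1})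
    (by simp)
  simpa only [past, Set.mem_singleton_iff, iSup_iSup_eq_left] using h1

end Past

section Causality

variable {Ω : Type*} [mΩ : MeasurableSpace Ω] {P : Measure Ω} [IsProbabilityMeasure P]
  {H : Type*} [NormedAddCommGroup H] [InnerProductSpace ℝ H] [CompleteSpace H]
  [MeasurableSpace H] [BorelSpace H] {Ψ : H →L[ℝ] H} {X ε : ℤ → Ω → H}

theorem IsStationaryFAR1.identDistrib_X (h : IsStationaryFAR1 P Ψ X ε) (t : ℤ) :
    IdentDistrib (X t) (X 0) P P := by
  have := (h.stationary t).comp (u := fun x : ℤ → H => x 0) (measurable_pi_apply 0)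
  simpa [Function.comp_def] using this

theorem IsStationaryFAR1.lintegral_X (h : IsStationaryFAR1 P Ψ X ε) {g : H → ℝ≥0∞}
    (hg : Measurable g) (t : ℤ) : ∫⁻ ω, g (X t ω) ∂P = ∫⁻ ω, g (X 0 ω) ∂P :=
  ((h.identDistrib_X t).comp hg).lintegral_eq

theorem IsStationaryFAR1.lintegral_ε (h : IsStationaryFAR1 P Ψ X ε) {g : H → ℝ≥0∞}
    (hg : Measurable g) (t : ℤ) : ∫⁻ ω, g (ε t ω) ∂P = ∫⁻ ω, g (ε 0 ω) ∂P :=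
  ((h.identDistrib t).comp hg).lintegral_eq

theorem IsStationaryFAR1.ae_recursion (h : IsStationaryFAR1 P Ψ X ε) :
    ∀ᵐ ω ∂P, ∀ t, X t ω = Ψ (X (t - 1) ω) + ε t ω :=
  ae_all_iff.2 h.recursion

/-- `Ψ ^ N X_{t-N}` is summable in `L¹`, hence tends to `0` almost surely. -/
theorem IsStationaryFAR1.ae_tendsto_pow (h : IsStationaryFAR1 P Ψ X ε) (hX : MemLp (X 0) 1 P)
    (t : ℤ) : ∀ᵐ ω ∂P, Tendsto (fun N : ℕ => (Ψ ^ N) (X (t - N) ω)) atTop (𝓝 0) := by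
  set g : ℕ → Ω → ℝ≥0∞ := fun N ω => ‖Ψ‖ₑ ^ N * ‖X (t - N) ω‖ₑ with hg
  have hgm : ∀ N, Measurable (g N) := fun N => ((h.measurable_X _).enorm).const_mul _
  have hΨ : ‖Ψ‖ₑ < 1 := by
    rw [← ofReal_norm, ← ENNReal.ofReal_one]
    exact (ENNReal.ofReal_lt_ofReal_iff one_pos).2 h.norm_lt_one
  have hfin : ∫⁻ ω, ∑' N, g N ω ∂P ≠ ∞ := by
    rw [lintegral_tsum fun N => (hgm N).aemeasurable]
    have : ∀ N, ∫⁻ ω, g N ω ∂P = ‖Ψ‖ₑ ^ N * ∫⁻ ω, ‖X 0 ω‖ₑ ∂P := fun N => by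
      rw [lintegral_const_mul _ (h.measurable_X _).enorm, h.lintegral_X measurable_enorm]
    simp only [this]
    rw [ENNReal.tsum_mul_right, ENNReal.tsum_geometric]
    refine ENNReal.mul_ne_top (ENNReal.inv_ne_top.2 (tsub_pos_of_lt hΨ).ne') ?_
    exact (memLp_one_iff_integrable.1 hX).hasFiniteIntegral.ne
  filter_upwards [ae_lt_top (Measurable.tsum hgm) hfin] with ω hω
  have h1 := ENNReal.tendsto_atTop_zero_of_tsum_ne_top hω.ne
  rw [tendsto_zero_iff_enorm_tendsto_zero]
  refine tendsto_of_tendsto_of_tendsto_of_le_of_le tendsto_const_nhds h1 (fun _ => zero_le) ?_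
  intro N
  refine ((Ψ ^ N).le_opENorm _).trans ?_
  simp only [hg]
  gcongr
  rw [← ofReal_norm, ← ofReal_norm, ← ENNReal.ofReal_pow (norm_nonneg _)]
  refine ENNReal.ofReal_le_ofReal ?_
  rcases N with _ | N
  · simpa [ContinuousLinearMap.one_def] using ContinuousLinearMap.norm_id_le (𝕜 := ℝ) (E := H)
  · exact norm_pow_le' _ N.succ_pos

/-- The stationary solution is causal: `X_t = ∑ⱼ Ψ ^ j ε_{t-j}` almost surely. -/
theorem IsStationaryFAR1.aestronglyMeasurable_inner (h : IsStationaryFAR1 P Ψ X ε)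
    (hX : MemLp (X 0) 1 P) (t : ℤ) (b : H) :
    AEStronglyMeasurable[past ε t] (fun ω => inner ℝ (X t ω) b) P := by
  set Z : ℕ → Ω → ℝ := fun N ω => ∑ j ∈ Finset.range N, inner ℝ ((Ψ ^ j) (ε (t - j) ω)) b with hZ
  have hZm : ∀ N, Measurable[past ε t] (Z N) := fun N => by
    refine Finset.measurable_fun_sum _ fun j _ => ?_
    have hc : Measurable (fun y : H => inner ℝ ((Ψ ^ j) y) b) := by
      have : Continuous (fun y : H => inner ℝ ((Ψ ^ j) y) b) := by fun_prop
      exact this.measurable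
    exact hc.comp (measurable_past ε (by omega))
  refine ⟨fun ω => limsup (fun N => Z N ω) atTop, (Measurable.limsup hZm).stronglyMeasurable, ?_⟩
  filter_upwards [h.ae_recursion, h.ae_tendsto_pow hX t] with ω hω hlim
  have h1 : Tendsto (fun N => Z N ω) atTop (𝓝 (inner ℝ (X t ω) b)) := by
    have h2 : (fun N => Z N ω) = fun N : ℕ =>
        inner ℝ (X t ω) b - inner ℝ ((Ψ ^ N) (X (t - N) ω)) b := by
      ext N
      have := eq_sum_pow_apply_add (x := fun s => X s ω) (e := fun s => ε s ω) hω t N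
      nth_rewrite 1 [this]
      rw [inner_add_left, add_sub_cancel_right, sum_inner]
    rw [h2]
    have h3 := (hlim.inner (𝕜 := ℝ) (tendsto_const_nhds (x := b))).const_sub (inner ℝ (X t ω) b)
    simpa using h3
  exact h1.limsup_eq.symm

end Causality

/-! ### Second moments of the martingale sums -/

section Moments

variable {Ω : Type*} [mΩ : MeasurableSpace Ω] {P : Measure Ω} [IsProbabilityMeasure P]
  {H : Type*} [NormedAddCommGroup H] [InnerProductSpace ℝ H] [CompleteSpace H]
  [MeasurableSpace H] [BorelSpace H] {Ψ : H →L[ℝ] H} {X ε : ℤ → Ω → H}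

theorem measurable_inner_left (b : H) : Measurable (fun y : H => inner ℝ y b) :=
  (show Continuous (fun y : H => inner ℝ y b) by fun_prop).measurable

theorem tsum_lintegral_inner_sq (φ : HilbertBasis ℕ ℝ H) {Y : Ω → H} (hY : Measurable Y) :
    ∑' i, ∫⁻ ω, ‖inner ℝ (Y ω) (φ i)‖ₑ ^ 2 ∂P = ∫⁻ ω, ‖Y ω‖ₑ ^ 2 ∂P := by
  have hm : ∀ i, Measurable (fun ω => inner ℝ (Y ω) (φ i)) := fun i =>
    (measurable_inner_left _).comp hY
  rw [← lintegral_tsum fun i => ((hm i).enorm.pow_const 2).aemeasurable]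
  simp only [parseval_enorm]

theorem IsStationaryFAR1.indep_past (h : IsStationaryFAR1 P Ψ X ε) {g : H → ℝ} (hg : Measurable g)
    (t : ℤ) : Indep (past ε t)
      (MeasurableSpace.comap (fun ω => g (ε (t + 1) ω)) inferInstance) P :=
  indep_of_indep_of_le_right (FAR.indep_past h.measurable_ε h.indep t)
    (hg.comp (comap_measurable _)).comap_le

/-- Orthogonality for the differences `p t * g (ε (t + 1))`; with `p` and `g` entries in a Hilbert basis,
this computes the Hilbert–Schmidt norms of the operator-valued sums below. -/
theorem IsStationaryFAR1.lintegral_sq_sum (h : IsStationaryFAR1 P Ψ X ε) {p : ℕ → Ω → ℝ}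
    (hp : ∀ t : ℕ, AEStronglyMeasurable[past ε t] (p t) P) (hpL : ∀ t, MemLp (p t) 2 P)
    {g : H → ℝ} (hg : Measurable g) (hgL : MemLp (fun ω => g (ε 0 ω)) 2 P)
    (hg0 : ∫ ω, g (ε 0 ω) ∂P = 0) (s : Finset ℕ) :
    ∫⁻ ω, ‖∑ t ∈ s, p t ω * g (ε (t + 1) ω)‖ₑ ^ 2 ∂P =
      ∑ t ∈ s, (∫⁻ ω, ‖p t ω‖ₑ ^ 2 ∂P) * ∫⁻ ω, ‖g (ε 0 ω)‖ₑ ^ 2 ∂P := by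
  have hid : ∀ t, IdentDistrib (fun ω => g (ε t ω)) (fun ω => g (ε 0 ω)) P P := fun t =>
    (h.identDistrib t).comp hg
  rw [lintegral_enorm_sq_sum_mul (q := fun t ω => g (ε (t + 1) ω)) (G := fun t : ℕ => past ε t)
    (fun _ _ hab => past_mono ε (by exact_mod_cast hab)) hp
    (fun t => hg.comp (measurable_past ε (by push_cast; rfl))) hpL
    (fun t => (hid (t + 1)).symm.memLp_snd hgL) (fun t => (hid _).integral_eq.trans hg0)
    (fun t => h.indep_past hg t)]
  refine Finset.sum_congr rfl fun t _ => ?_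
  rw [h.lintegral_ε (g := fun y => ‖g y‖ₑ ^ 2) (hg.enorm.pow_const 2)]

theorem IsStationaryFAR1.integral_inner_ε (h : IsStationaryFAR1 P Ψ X ε) (t : ℤ) (b : H) :
    ∫ ω, inner ℝ (ε t ω) b ∂P = 0 := by
  have hi : Integrable (ε t) P := (h.memLp t).integrable (by norm_num)
  simp only [real_inner_comm b]
  rw [integral_inner hi, h.mean_zero, inner_zero_right]

theorem IsStationaryFAR1.memLp_inner_ε (h : IsStationaryFAR1 P Ψ X ε) (t : ℤ) (b : H) :
    MemLp (fun ω => inner ℝ (ε t ω) b) 4 P := (h.memLp t).inner_const b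

theorem IsStationaryFAR1.lintegral_norm_sum_ε (h : IsStationaryFAR1 P Ψ X ε)
    (φ : HilbertBasis ℕ ℝ H) (s : Finset ℕ) :
    ∫⁻ ω, ‖∑ t ∈ s, ε (t + 1) ω‖ₑ ^ 2 ∂P = s.card * ∫⁻ ω, ‖ε 0 ω‖ₑ ^ 2 ∂P := by
  have hm : ∀ t i, Measurable (fun ω => inner ℝ (ε t ω) (φ i)) := fun t i =>
    (measurable_inner_left _).comp (h.measurable_ε t)
  simp only [← parseval_enorm φ (∑ t ∈ s, _), sum_inner]
  rw [lintegral_tsum fun i =>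
    ((Finset.measurable_fun_sum s fun t _ => hm _ i).enorm.pow_const 2).aemeasurable,
    ← tsum_lintegral_inner_sq φ (h.measurable_ε 0), ← ENNReal.tsum_mul_left]
  refine tsum_congr fun i => ?_
  have := h.lintegral_sq_sum (p := fun _ _ => 1) (fun _ => aestronglyMeasurable_const)
    (fun _ => memLp_const 1) (measurable_inner_left (φ i))
    ((h.memLp_inner_ε 0 _).mono_exponent (by norm_num)) (h.integral_inner_ε 0 _) s
  simpa using this

theorem IsStationaryFAR1.memLp_X (h : IsStationaryFAR1 P Ψ X ε) {p : ℝ≥0∞} (hX : MemLp (X 0) p P)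
    (t : ℤ) : MemLp (X t) p P :=
  (h.identDistrib_X t).symm.memLp_snd hX

theorem IsStationaryFAR1.lintegral_hsNorm_sum_rankOne (h : IsStationaryFAR1 P Ψ X ε)
    (hX : MemLp (X 0) 2 P) (φ : HilbertBasis ℕ ℝ H) (s : Finset ℕ) :
    ∫⁻ ω, hsNorm (∑ t ∈ s, rankOne ℝ (ε (t + 1) ω) (X t ω)) ^ 2 ∂P =
      s.card * ((∫⁻ ω, ‖X 0 ω‖ₑ ^ 2 ∂P) * ∫⁻ ω, ‖ε 0 ω‖ₑ ^ 2 ∂P) := by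
  have hm : ∀ t i, Measurable (fun ω => inner ℝ (ε t ω) (φ i)) := fun t i =>
    (measurable_inner_left _).comp (h.measurable_ε t)
  have hmX : ∀ t i, Measurable (fun ω => inner ℝ (X t ω) (φ i)) := fun t i =>
    (measurable_inner_left _).comp (h.measurable_X t)
  simp only [hsNorm_sq_eq_tsum_entries φ, sum_apply, InnerProductSpace.rankOne_apply, sum_inner,
    real_inner_smul_left]
  have hmm : ∀ i j, Measurable fun ω =>
      ‖∑ t ∈ s, inner ℝ (X t ω) (φ i) * inner ℝ (ε (t + 1) ω) (φ j)‖ₑ ^ 2 := fun i j =>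
    (Finset.measurable_fun_sum s fun t _ => (hmX _ i).mul (hm _ j)).enorm.pow_const 2
  rw [lintegral_tsum fun i => (Measurable.tsum fun j => hmm i j).aemeasurable,
    ← tsum_lintegral_inner_sq φ (h.measurable_ε 0), ← tsum_lintegral_inner_sq φ (h.measurable_X 0),
    ← ENNReal.tsum_mul_right, ← ENNReal.tsum_mul_left]
  refine tsum_congr fun i => ?_
  rw [lintegral_tsum fun j => (hmm i j).aemeasurable, ← ENNReal.tsum_mul_left,
    ← ENNReal.tsum_mul_left]
  refine tsum_congr fun j => ?_
  rw [h.lintegral_sq_sum (p := fun t ω => inner ℝ (X t ω) (φ i))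
    (fun t => h.aestronglyMeasurable_inner (hX.mono_exponent (by norm_num)) t _)
    (fun t => (h.memLp_X hX t).inner_const _) (measurable_inner_left (φ j))
    ((h.memLp_inner_ε 0 _).mono_exponent (by norm_num)) (h.integral_inner_ε 0 _) s]
  simp only [h.lintegral_X (g := fun y => ‖inner ℝ y (φ i)‖ₑ ^ 2)
    ((measurable_inner_left _).enorm.pow_const 2), Finset.sum_const, nsmul_eq_mul]

/-- The variance is at most the second moment. -/
theorem lintegral_enorm_sub_integral_sq_le {f : Ω → ℝ} (hf : MemLp f 2 P) :
    ∫⁻ ω, ‖f ω - ∫ ω', f ω' ∂P‖ₑ ^ 2 ∂P ≤ ∫⁻ ω, ‖f ω‖ₑ ^ 2 ∂P := by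
  have hc : MemLp (fun ω => f ω - ∫ ω', f ω' ∂P) 2 P := hf.sub (memLp_const _)
  rw [lintegral_enorm_sq_eq hc, lintegral_enorm_sq_eq hf]
  refine ENNReal.ofReal_le_ofReal ?_
  rw [← variance_eq_integral hf.1.aemeasurable]
  exact variance_le_expectation_sq hf.1

theorem IsStationaryFAR1.lintegral_hsNorm_sum_centred_le (h : IsStationaryFAR1 P Ψ X ε)
    (φ : HilbertBasis ℕ ℝ H) {D : H →L[ℝ] H}
    (hD : ∀ u v, inner ℝ (D u) v = ∫ ω, inner ℝ (ε 0 ω) u * inner ℝ (ε 0 ω) v ∂P)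
    (s : Finset ℕ) :
    ∫⁻ ω, hsNorm (∑ t ∈ s, (rankOne ℝ (ε (t + 1) ω) (ε (t + 1) ω) - D)) ^ 2 ∂P ≤
      s.card * ∫⁻ ω, ‖ε 0 ω‖ₑ ^ 4 ∂P := by
  have hm : ∀ t i, Measurable (fun ω => inner ℝ (ε t ω) (φ i)) := fun t i =>
    (measurable_inner_left _).comp (h.measurable_ε t)
  simp only [hsNorm_sq_eq_tsum_entries φ, sum_apply, sub_apply, InnerProductSpace.rankOne_apply,
    sum_inner, inner_sub_left, real_inner_smul_left]
  have hmm : ∀ i j, Measurable fun ω =>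
      ‖∑ t ∈ s, (inner ℝ (ε (t + 1) ω) (φ i) * inner ℝ (ε (t + 1) ω) (φ j)
        - inner ℝ (D (φ i)) (φ j))‖ₑ ^ 2 := fun i j =>
    (Finset.measurable_fun_sum s fun t _ =>
      ((hm _ i).mul (hm _ j)).sub_const _).enorm.pow_const 2
  have hm2 : ∀ i j, Measurable fun ω => ‖inner ℝ (ε 0 ω) (φ i) * inner ℝ (ε 0 ω) (φ j)‖ₑ ^ 2 :=
    fun i j => ((hm 0 i).mul (hm 0 j)).enorm.pow_const 2
  have h4 : ∫⁻ ω, ‖ε 0 ω‖ₑ ^ 4 ∂P =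
      ∑' i, ∑' j, ∫⁻ ω, ‖inner ℝ (ε 0 ω) (φ i) * inner ℝ (ε 0 ω) (φ j)‖ₑ ^ 2 ∂P := by
    have : ∀ i, ∑' j, ∫⁻ ω, ‖inner ℝ (ε 0 ω) (φ i) * inner ℝ (ε 0 ω) (φ j)‖ₑ ^ 2 ∂P =
        ∫⁻ ω, ∑' j, ‖inner ℝ (ε 0 ω) (φ i) * inner ℝ (ε 0 ω) (φ j)‖ₑ ^ 2 ∂P := fun i =>
      (lintegral_tsum fun j => (hm2 i j).aemeasurable).symm
    simp only [this]
    rw [← lintegral_tsum fun i => (Measurable.tsum fun j => hm2 i j).aemeasurable]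
    simp only [enorm_mul, mul_pow, ENNReal.tsum_mul_left, ENNReal.tsum_mul_right, parseval_enorm]
    simp only [← pow_add]
  rw [lintegral_tsum fun i => (Measurable.tsum fun j => hmm i j).aemeasurable, h4,
    ← ENNReal.tsum_mul_left]
  refine ENNReal.tsum_le_tsum fun i => ?_
  rw [lintegral_tsum fun j => (hmm i j).aemeasurable, ← ENNReal.tsum_mul_left]
  refine ENNReal.tsum_le_tsum fun j => ?_
  have : ENNReal.HolderTriple 4 4 2 := ⟨by
    rw [← two_mul, show (4 : ℝ≥0∞) = 2 * 2 by norm_num,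
      ENNReal.mul_inv (by simp) (by simp), ← mul_assoc,
      ENNReal.mul_inv_cancel (by simp) (by simp), one_mul]⟩
  have hL : MemLp (fun ω => inner ℝ (ε 0 ω) (φ i) * inner ℝ (ε 0 ω) (φ j)) 2 P :=
    (h.memLp_inner_ε 0 (φ j)).mul' (h.memLp_inner_ε 0 (φ i))
  have h1 := h.lintegral_sq_sum (p := fun _ _ => 1) (fun _ => aestronglyMeasurable_const)
    (fun _ => memLp_const 1)
    (g := fun y => inner ℝ y (φ i) * inner ℝ y (φ j) - inner ℝ (D (φ i)) (φ j))
    (((measurable_inner_left _).mul (measurable_inner_left _)).sub_const _)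
    (hL.sub (memLp_const _))
    (by
      rw [integral_sub (hL.integrable (by norm_num)) (integrable_const _), ← hD]
      simp) s
  simp only [one_mul, enorm_one, one_pow, lintegral_const, measure_univ, mul_one,
    Finset.sum_const, nsmul_eq_mul] at h1
  rw [h1]
  rw [hD]
  refine mul_le_mul_right ?_ _
  exact lintegral_enorm_sub_integral_sq_le hL

/-! ### The covariance operator -/

theorem inner_covOp {Y : Ω → H} (hY : MemLp Y 2 P) (u v : H) :
    inner ℝ (covOp P Y u) v = ∫ ω, inner ℝ (Y ω) u * inner ℝ (Y ω) v ∂P := by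
  have hi : Integrable (fun ω => rankOne ℝ (Y ω) (Y ω)) P := by
    refine (hY.integrable_norm_pow (by norm_num)).mono' ?_ (ae_of_all _ fun ω => ?_)
    · have hc : Continuous (fun y : H => rankOne ℝ y y) :=
        (rankOne ℝ (E := H) (F := H)).continuous₂.comp (continuous_id.prodMk continuous_id)
      exact hc.comp_aestronglyMeasurable hY.1
    · rw [InnerProductSpace.norm_rankOne, ← sq]
  have h1 := ((innerSL ℝ v) ∘L (ContinuousLinearMap.apply ℝ H u)).integral_comp_comm hi
  simp only [ContinuousLinearMap.comp_apply, ContinuousLinearMap.apply_apply, innerSL_apply_apply,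
    InnerProductSpace.rankOne_apply, inner_smul_right] at h1
  rw [real_inner_comm, covOp, ← h1]
  simp only [real_inner_comm]

/-- `C₀ - Ψ C₀ Ψ*` is the covariance operator of the innovations. -/
theorem IsStationaryFAR1.inner_covOp_sub (h : IsStationaryFAR1 P Ψ X ε) (hX : MemLp (X 0) 2 P)
    (u v : H) :
    inner ℝ ((covOp P (X 0) - Ψ ∘L covOp P (X 0) ∘L adjoint Ψ) u) v =
      ∫ ω, inner ℝ (ε 0 ω) u * inner ℝ (ε 0 ω) v ∂P := by
  have hXL : ∀ t b, MemLp (fun ω => inner ℝ (X t ω) b) 2 P := fun t b =>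
    (h.memLp_X hX t).inner_const b
  have hεL : ∀ t b, MemLp (fun ω => inner ℝ (ε t ω) b) 2 P := fun t b =>
    (h.memLp_inner_ε t b).mono_exponent (by norm_num)
  have hstat : ∫ ω, inner ℝ (X 0 ω) u * inner ℝ (X 0 ω) v ∂P =
      ∫ ω, inner ℝ (X 1 ω) u * inner ℝ (X 1 ω) v ∂P :=
    (((h.identDistrib_X 1).comp (u := fun y => inner ℝ y u * inner ℝ y v)
      ((measurable_inner_left u).mul (measurable_inner_left v))).integral_eq).symm
  have hεstat : ∫ ω, inner ℝ (ε 0 ω) u * inner ℝ (ε 0 ω) v ∂P =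
      ∫ ω, inner ℝ (ε 1 ω) u * inner ℝ (ε 1 ω) v ∂P :=
    (((h.identDistrib 1).comp (u := fun y => inner ℝ y u * inner ℝ y v)
      ((measurable_inner_left u).mul (measurable_inner_left v))).integral_eq).symm
  have hcross : ∀ a b, ∫ ω, inner ℝ (X 0 ω) a * inner ℝ (ε 1 ω) b ∂P = 0 := fun a b => by
    have hi := indepFun_of_aestronglyMeasurable
      (h.aestronglyMeasurable_inner (hX.mono_exponent (by norm_num)) 0 a)
      (h.indep_past (measurable_inner_left b) 0)
    rw [zero_add] at hi
    rw [hi.integral_fun_mul_eq_mul_integral (hXL 0 a).1 (hεL 1 b).1, h.integral_inner_ε, mul_zero]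
  have hexp : ∀ᵐ ω ∂P, inner ℝ (X 1 ω) u * inner ℝ (X 1 ω) v =
      inner ℝ (X 0 ω) (adjoint Ψ u) * inner ℝ (X 0 ω) (adjoint Ψ v)
      + inner ℝ (X 0 ω) (adjoint Ψ u) * inner ℝ (ε 1 ω) v
      + inner ℝ (X 0 ω) (adjoint Ψ v) * inner ℝ (ε 1 ω) u
      + inner ℝ (ε 1 ω) u * inner ℝ (ε 1 ω) v := by
    filter_upwards [h.recursion 1] with ω hω
    rw [hω, sub_self]
    simp only [inner_add_left, ContinuousLinearMap.adjoint_inner_right]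
    ring
  have i1 := (hXL 0 (adjoint Ψ u)).integrable_mul (hXL 0 (adjoint Ψ v))
  have i2 := (hXL 0 (adjoint Ψ u)).integrable_mul (hεL 1 v)
  have i3 := (hXL 0 (adjoint Ψ v)).integrable_mul (hεL 1 u)
  have i4 := (hεL 1 u).integrable_mul (hεL 1 v)
  have hsum := integral_add ((i1.add i2).add i3) i4
  rw [integral_add' (i1.add i2) i3, integral_add' i1 i2] at hsum
  simp only [Pi.add_apply, Pi.mul_apply] at hsum
  rw [sub_apply, inner_sub_left, ContinuousLinearMap.comp_apply, ContinuousLinearMap.comp_apply,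
    ← ContinuousLinearMap.adjoint_inner_right Ψ, inner_covOp hX, inner_covOp hX, hstat, hεstat,
    integral_congr_ae hexp, hsum, hcross, hcross]
  ring

end Moments

/-! ### Polynomial rates -/

namespace IsBigOInProb

variable {Ω : Type*} [MeasurableSpace Ω] {P : Measure Ω} {Y Z : ℕ → Ω → ℝ≥0∞} {a b c : ℝ}

theorem weaken_rpow (hY : IsBigOInProb P Y fun n => (n : ℝ) ^ a) (h : a ≤ b) :
    IsBigOInProb P Y fun n => (n : ℝ) ^ b := by
  refine hY.mono_rate one_pos ?_
  filter_upwards [eventually_ge_atTop 1] with n hn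
  rw [one_mul]
  exact Real.rpow_le_rpow_of_exponent_le (by exact_mod_cast hn) h

theorem add_rpow (hY : IsBigOInProb P Y fun n => (n : ℝ) ^ a)
    (hZ : IsBigOInProb P Z fun n => (n : ℝ) ^ a) :
    IsBigOInProb P (fun n ω => Y n ω + Z n ω) fun n => (n : ℝ) ^ a :=
  hY.add (fun n => Real.rpow_nonneg n.cast_nonneg a) hZ

theorem mul_rpow (hY : IsBigOInProb P Y fun n => (n : ℝ) ^ a)
    (hZ : IsBigOInProb P Z fun n => (n : ℝ) ^ b) (h : a + b ≤ c) :
    IsBigOInProb P (fun n ω => Y n ω * Z n ω) fun n => (n : ℝ) ^ c := by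
  refine (hY.mul (fun n => Real.rpow_nonneg n.cast_nonneg a) hZ).mono_rate one_pos ?_
  filter_upwards [eventually_ge_atTop 1] with n hn
  rw [one_mul, ← Real.rpow_add (by exact_mod_cast hn)]
  exact Real.rpow_le_rpow_of_exponent_le (by exact_mod_cast hn) h

theorem const_rpow {k : ℝ≥0∞} (hk : k ≠ ∞) (h : 0 ≤ a) :
    IsBigOInProb P (fun _ _ => k) fun n => (n : ℝ) ^ a := by
  have : IsBigOInProb P (fun _ _ => k) fun n => (n : ℝ) ^ (0 : ℝ) := by
    simpa only [Real.rpow_zero] using const hk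
  exact this.weaken_rpow h

/-- Markov's inequality for sums of `n` orthogonal terms. -/
theorem of_lintegral_sq_le_card {K : ℝ≥0∞} (hK : K ≠ ∞) {s : ℕ → Finset ℕ}
    (hs : ∀ n, (s n).card ≤ n) (hmeas : ∀ n, AEMeasurable (fun ω => Y n ω ^ 2) P)
    (h : ∀ n, ∫⁻ ω, Y n ω ^ 2 ∂P ≤ (s n).card * K) :
    IsBigOInProb P Y fun n => (n : ℝ) ^ (1 / 2 : ℝ) := by
  refine of_lintegral_sq hK ?_ hmeas (Eventually.of_forall fun n => (h n).trans ?_)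
  · filter_upwards [eventually_gt_atTop 0] with n hn
    have : (0 : ℝ) < n := by exact_mod_cast hn
    positivity
  · rw [mul_comm, ← ENNReal.ofReal_pow (by positivity), ← Real.rpow_natCast, ← Real.rpow_mul
      n.cast_nonneg]
    norm_num
    gcongr
    exact hs n

end IsBigOInProb

/-! ### Rates for the sample moments -/

section Rates

variable {Ω : Type*} [mΩ : MeasurableSpace Ω] {P : Measure Ω} [IsProbabilityMeasure P]
  {H : Type*} [NormedAddCommGroup H] [InnerProductSpace ℝ H] [CompleteSpace H]
  [MeasurableSpace H] [BorelSpace H] {Ψ : H →L[ℝ] H} {X ε : ℤ → Ω → H}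

theorem lintegral_enorm_pow_ne_top {Y : Ω → H} {k : ℕ} (hk : k ≠ 0) (hY : MemLp Y k P) :
    ∫⁻ ω, ‖Y ω‖ₑ ^ k ∂P ≠ ∞ := by
  have := lintegral_rpow_enorm_lt_top_of_eLpNorm_lt_top (p := k) (by exact_mod_cast hk)
    (by simp) hY.2
  simpa using this.ne

theorem measurable_hsNorm_sq (φ : HilbertBasis ℕ ℝ H) {T : Ω → H →L[ℝ] H}
    (h : ∀ u v, Measurable fun ω => inner ℝ (T ω u) v) : Measurable fun ω => hsNorm (T ω) ^ 2 := by
  simp only [hsNorm_sq_eq_tsum_entries φ]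
  exact Measurable.tsum fun i => Measurable.tsum fun j => (h _ _).enorm.pow_const 2

theorem measurable_inner_sum_rankOne {Y Z : ℕ → Ω → H} (hY : ∀ t, Measurable (Y t))
    (hZ : ∀ t, Measurable (Z t)) (D : H →L[ℝ] H) (s : Finset ℕ) (u v : H) :
    Measurable fun ω => inner ℝ ((∑ t ∈ s, (rankOne ℝ (Y t ω) (Z t ω) - D)) u) v := by
  simp only [sum_apply, sub_apply, InnerProductSpace.rankOne_apply, sum_inner, inner_sub_left,
    real_inner_smul_left]
  exact Finset.measurable_fun_sum s fun t _ =>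
    (((measurable_inner_left u).comp (hZ t)).mul
      ((measurable_inner_left v).comp (hY t))).sub_const _

namespace IsStationaryFAR1

variable (h : IsStationaryFAR1 P Ψ X ε)
include h

theorem isBigO_X (hX : MemLp (X 0) 2 P) (τ : ℕ → ℤ) :
    IsBigOInProb P (fun n ω => ‖X (τ n) ω‖ₑ) fun n => (n : ℝ) ^ (0 : ℝ) := by
  simp only [Real.rpow_zero]
  refine IsBigOInProb.of_lintegral_sq (lintegral_enorm_pow_ne_top two_ne_zero hX) (by simp)
    (fun n => ((h.measurable_X _).enorm.pow_const 2).aemeasurable)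
    (Eventually.of_forall fun n => ?_)
  rw [h.lintegral_X (g := fun y => ‖y‖ₑ ^ 2) (by fun_prop)]
  simp

theorem isBigO_sum_ε (φ : HilbertBasis ℕ ℝ H) {s : ℕ → Finset ℕ} (hs : ∀ n, (s n).card ≤ n) :
    IsBigOInProb P (fun n ω => ‖∑ t ∈ s n, ε (t + 1) ω‖ₑ) fun n => (n : ℝ) ^ (1 / 2 : ℝ) := by
  refine IsBigOInProb.of_lintegral_sq_le_card
    (lintegral_enorm_pow_ne_top two_ne_zero ((h.memLp 0).mono_exponent (by norm_num))) hs
    (fun n => ?_) fun n => (h.lintegral_norm_sum_ε φ (s n)).le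
  exact (Finset.aestronglyMeasurable_fun_sum (s n) fun t _ => (h.memLp (t + 1)).1).enorm.pow_const 2

theorem isBigO_sum_rankOne (hX : MemLp (X 0) 2 P) (φ : HilbertBasis ℕ ℝ H) {s : ℕ → Finset ℕ}
    (hs : ∀ n, (s n).card ≤ n) :
    IsBigOInProb P (fun n ω => hsNorm (∑ t ∈ s n, rankOne ℝ (ε (t + 1) ω) (X t ω)))
      fun n => (n : ℝ) ^ (1 / 2 : ℝ) := by
  refine IsBigOInProb.of_lintegral_sq_le_card (ENNReal.mul_ne_top
    (lintegral_enorm_pow_ne_top two_ne_zero hX)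
    (lintegral_enorm_pow_ne_top two_ne_zero ((h.memLp 0).mono_exponent (by norm_num)))) hs
    (fun n => (measurable_hsNorm_sq φ fun u v => ?_).aemeasurable)
    fun n => (h.lintegral_hsNorm_sum_rankOne hX φ (s n)).le
  simpa using measurable_inner_sum_rankOne (fun t => h.measurable_ε (t + 1))
    (fun t => h.measurable_X t) 0 (s n) u v

theorem isBigO_sum_centred (φ : HilbertBasis ℕ ℝ H) {D : H →L[ℝ] H}
    (hD : ∀ u v, inner ℝ (D u) v = ∫ ω, inner ℝ (ε 0 ω) u * inner ℝ (ε 0 ω) v ∂P)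
    {s : ℕ → Finset ℕ} (hs : ∀ n, (s n).card ≤ n) :
    IsBigOInProb P
      (fun n ω => hsNorm (∑ t ∈ s n, (rankOne ℝ (ε (t + 1) ω) (ε (t + 1) ω) - D)))
      fun n => (n : ℝ) ^ (1 / 2 : ℝ) :=
  IsBigOInProb.of_lintegral_sq_le_card
    (lintegral_enorm_pow_ne_top four_ne_zero (by exact_mod_cast h.memLp 0)) hs
    (fun n => (measurable_hsNorm_sq φ fun u v =>
      measurable_inner_sum_rankOne (fun t => h.measurable_ε (t + 1))
        (fun t => h.measurable_ε (t + 1)) D (s n) u v).aemeasurable)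
    fun n => h.lintegral_hsNorm_sum_centred_le φ hD (s n)

theorem isBigO_sampleMean (hX : MemLp (X 0) 2 P) (φ : HilbertBasis ℕ ℝ H) :
    IsBigOInProb P (fun n ω => ‖sampleMean n (fun t => X t ω)‖ₑ)
      fun n => (n : ℝ) ^ (-(1 / 2) : ℝ) := by
  have hS := h.isBigO_sum_ε φ (s := Finset.range) (fun n => (Finset.card_range n).le)
  have hX0 := (h.isBigO_X hX fun _ => 0).weaken_rpow (b := 1 / 2) (by norm_num)
  have hXn := (h.isBigO_X hX fun n => n).weaken_rpow (b := 1 / 2) (by norm_num)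
  have hn : IsBigOInProb P (fun n _ => ENNReal.ofReal ((n : ℝ)⁻¹ * (1 - ‖Ψ‖)⁻¹))
      fun n => (n : ℝ) ^ (-1 : ℝ) := by
    refine IsBigOInProb.of_le (K := (1 - ‖Ψ‖)⁻¹) (by have := h.norm_lt_one; simpa) <|
      Eventually.of_forall fun n _ => ?_
    rw [Real.rpow_neg_one, mul_comm]
  refine (hn.mul_rpow ((hX0.add_rpow hXn).add_rpow hS) (by norm_num)).mono <|
    Eventually.of_forall fun n => ?_
  filter_upwards [h.ae_recursion] with ω hω
  have h1 := norm_sum_le_of_recursion (x := fun t => X t ω) (e := fun t => ε t ω) hω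
    h.norm_lt_one n
  simp only [← ofReal_norm]
  rw [← ENNReal.ofReal_add (by positivity) (by positivity),
    ← ENNReal.ofReal_add (by positivity) (by positivity),
    ← ENNReal.ofReal_mul' (by positivity)]
  refine ENNReal.ofReal_le_ofReal ?_
  rw [sampleMean, sum_Icc_one_eq (fun t => X t ω), norm_smul, norm_inv, Real.norm_natCast,
    mul_assoc]
  gcongr

theorem isBigO_sampleC0_sub (hX : MemLp (X 0) 2 P) (φ : HilbertBasis ℕ ℝ H) :
    IsBigOInProb P (fun n ω => ‖sampleC0 n (fun t => X t ω) - covOp P (X 0)‖ₑ)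
      fun n => (n : ℝ) ^ (-(1 / 2) : ℝ) := by
  have hr : ∀ n, (Finset.range n).card ≤ n := fun n => (Finset.card_range n).le
  have hN := h.isBigO_sum_rankOne hX φ hr
  have hM := h.isBigO_sum_centred φ (h.inner_covOp_sub hX) hr
  have hX0 := h.isBigO_X hX fun _ => 0
  have hXn := h.isBigO_X hX fun n => n
  have hX0' := hX0.mul_rpow hX0 (c := 1 / 2) (by norm_num)
  have hXn' := hXn.mul_rpow hXn (c := 1 / 2) (by norm_num)
  have hm := h.isBigO_sampleMean hX φ
  have hm' := hm.mul_rpow hm (c := -(1 / 2)) (by norm_num)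
  have hn : IsBigOInProb P (fun n _ => ENNReal.ofReal ((n : ℝ)⁻¹ * (1 - ‖Ψ‖)⁻¹))
      fun n => (n : ℝ) ^ (-1 : ℝ) := by
    refine IsBigOInProb.of_le (K := (1 - ‖Ψ‖)⁻¹) (by have := h.norm_lt_one; simpa) <|
      Eventually.of_forall fun n _ => ?_
    rw [Real.rpow_neg_one, mul_comm]
  refine ((hn.mul_rpow ((((hX0'.add_rpow hXn').add_rpow hN).add_rpow hN).add_rpow hM)
    (c := -(1 / 2)) (by norm_num)).add_rpow hm').mono ?_
  filter_upwards [eventually_ne_atTop 0] with n hn0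
  filter_upwards [h.ae_recursion] with ω hω
  have h1 := norm_sum_rankOne_sub_le (x := fun t => X t ω) (e := fun t => ε t ω) hω
    h.norm_lt_one (covOp P (X 0)) n
  rw [sampleC0_sub_eq hn0]
  refine enorm_sub_le.trans (add_le_add ?_ (by rw [InnerProductSpace.enorm_rankOne]))
  refine le_trans ?_ (mul_le_mul_right (add_le_add (add_le_add (add_le_add le_rfl
    (enorm_le_hsNorm _)) (enorm_le_hsNorm _)) (enorm_le_hsNorm _)) _)
  simp only [← ofReal_norm]
  rw [← ENNReal.ofReal_mul (by positivity), ← ENNReal.ofReal_mul (by positivity),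
    ← ENNReal.ofReal_add (by positivity) (by positivity),
    ← ENNReal.ofReal_add (by positivity) (by positivity),
    ← ENNReal.ofReal_add (by positivity) (by positivity),
    ← ENNReal.ofReal_add (by positivity) (by positivity),
    ← ENNReal.ofReal_mul' (by positivity)]
  refine ENNReal.ofReal_le_ofReal ?_
  rw [norm_smul, norm_inv, Real.norm_natCast, mul_assoc]
  gcongr
  refine h1.trans_eq ?_
  ring

/-- The recursion `C₁ = Ψ C₀` holds for the sample operators up to a term of order `n ^ (-1/2)`, in the
Hilbert–Schmidt norm. -/
theorem isBigO_sampleC1_sub (hX : MemLp (X 0) 2 P) (φ : HilbertBasis ℕ ℝ H)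
    (hΨ : hsNorm Ψ ≠ ∞) :
    IsBigOInProb P
      (fun n ω => hsNorm (sampleC1 n (fun t => X t ω) - Ψ ∘L sampleC0 n (fun t => X t ω)))
      fun n => (n : ℝ) ^ (-(1 / 2) : ℝ) := by
  have hr : ∀ n, (Finset.Ico 1 n).card ≤ n := fun n => by simp
  have hS := h.isBigO_sum_ε φ hr
  have hN := h.isBigO_sum_rankOne hX φ hr
  have hXn := h.isBigO_X hX fun n => n
  have hm := h.isBigO_sampleMean hX φ
  have hz := hXn.add_rpow (hm.weaken_rpow (b := 0) (by norm_num))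
  have hC : IsBigOInProb P (fun n ω => hsNorm Ψ *
      (‖sampleC0 n (fun t => X t ω) - covOp P (X 0)‖ₑ + ‖covOp P (X 0)‖ₑ))
      fun n => (n : ℝ) ^ (1 / 2 : ℝ) :=
    IsBigOInProb.const_mul hΨ
      (((h.isBigO_sampleC0_sub hX φ).weaken_rpow (by norm_num)).add_rpow
        (IsBigOInProb.const_rpow (by simp) (by norm_num)))
  have hn : IsBigOInProb P (fun n _ => ENNReal.ofReal ((n : ℝ) - 1)⁻¹)
      fun n => (n : ℝ) ^ (-1 : ℝ) := by
    refine IsBigOInProb.of_le (K := 2) two_pos ?_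
    filter_upwards [eventually_ge_atTop 2] with n hn _
    have hn2 : (2 : ℝ) ≤ n := by exact_mod_cast hn
    refine ENNReal.ofReal_le_ofReal ?_
    rw [Real.rpow_neg_one, inv_le_iff_one_le_mul₀ (by linarith), ← div_eq_mul_inv,
      div_mul_eq_mul_div, le_div_iff₀ (by linarith)]
    linarith
  have hb := (((hC.add_rpow (hz.mul_rpow hz (c := 1 / 2) (by norm_num))).add_rpow hN).add_rpow
    (hS.mul_rpow hm (c := 1 / 2) (by norm_num))).add_rpow
    ((hm.add_rpow hm).mul_rpow hz (c := 1 / 2) (by norm_num))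
  refine (hn.mul_rpow hb (by norm_num)).mono ?_
  filter_upwards [eventually_ge_atTop 2] with n hn
  filter_upwards [h.ae_recursion] with ω hω
  have hn2 : (2 : ℝ) ≤ n := by exact_mod_cast hn
  have key := smul_sampleC1_sub_eq (x := fun t => X t ω) (e := fun t => ε t ω) hω hn
  rw [← eq_inv_smul_iff₀ (by linarith : (n : ℝ) - 1 ≠ 0)] at key
  rw [key]
  set m := sampleMean n fun t => X t ω
  have hΨ1 : ‖Ψ‖ₑ ≤ 1 := by
    rw [← ofReal_norm, ← ENNReal.ofReal_one]
    exact ENNReal.ofReal_le_ofReal h.norm_lt_one.le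
  have hΨb : ∀ y, ‖Ψ y‖ₑ ≤ ‖y‖ₑ := fun y =>
    (Ψ.le_opENorm y).trans (mul_le_of_le_one_left' hΨ1)
  refine (hsNorm_smul _ _).trans ?_
  have hsc : ‖((n : ℝ) - 1)⁻¹‖ₑ = ENNReal.ofReal ((n : ℝ) - 1)⁻¹ :=
    Real.enorm_of_nonneg (inv_nonneg.2 (by linarith))
  rw [hsc]
  gcongr
  refine (hsNorm_add_le _ _).trans (add_le_add ((hsNorm_sub_le _ _).trans (add_le_add
    ((hsNorm_add_le _ _).trans (add_le_add ((hsNorm_sub_le _ _).trans (add_le_add ?_ ?_)) le_rfl))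
    (hsNorm_rankOne _ _).le)) ?_)
  · refine (hsNorm_comp_le' _ _).trans ?_
    gcongr
    have := enorm_add_le ((sampleC0 n fun t => X t ω) - covOp P (X 0)) (covOp P (X 0))
    rwa [sub_add_cancel] at this
  · refine (hsNorm_comp_le _ _).trans ((mul_le_of_le_one_left' hΨ1).trans ?_)
    rw [hsNorm_rankOne]
    exact mul_le_mul' (enorm_sub_le (E := H)) (enorm_sub_le (E := H))
  · rw [hsNorm_rankOne]
    exact mul_le_mul' ((enorm_sub_le (E := H)).trans (add_le_add (hΨb m) le_rfl))
      ((enorm_sub_le (E := H)).trans_eq (add_comm _ _))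

/-- The choice `α ≍ n ^ (-κ)`, `κ = 1 / (2 (min β 1 + 1))`, balances the stochastic error
`n ^ (-1/2) / α` against the bias `α ^ min β 1`. -/
theorem isBigO_tikhonov_sub (hX : MemLp (X 0) 2 P) {φ : HilbertBasis ℕ ℝ H} {lam : ℕ → ℝ}
    (hC : ∀ k, covOp P (X 0) (φ k) = lam k • φ k) (hpos : ∀ k, 0 < lam k) {c : ℝ}
    (hc : ∀ k, lam k ≤ c) (hlim : Tendsto lam atTop (𝓝 0)) {β : ℝ} (hβ : 0 < β) {F : H →L[ℝ] H}
    (hF : hsNorm F ≠ ∞) (hsource : Ψ = F ∘L spectralPow φ lam β) {α : ℕ → ℝ}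
    (hαpos : ∀ n, 0 < α n)
    (hα : α =Θ[atTop] fun n : ℕ => (n : ℝ) ^ (-(1 / (2 * (min β 1 + 1))))) :
    IsBigOInProb P (fun n ω => hsNorm (tikhonov n (α n) (fun t => X t ω) - Ψ))
      fun n => (n : ℝ) ^ (-(min β 1 / (2 * (min β 1 + 1)))) := by
  set g := min β 1 with hg
  have hg0 : 0 < g := lt_min hβ one_pos
  set κ := 1 / (2 * (g + 1)) with hκ
  have hrate : -(g / (2 * (g + 1))) = -(1 / 2) + κ := by rw [hκ]; field_simp; ring
  have hrate' : -(g / (2 * (g + 1))) = -κ * g := by rw [hκ]; ring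
  have hneg : -(g / (2 * (g + 1))) ≤ 0 := by
    rw [neg_nonpos]
    positivity
  have hc0 : 0 < c := (hpos 0).trans_le (hc 0)
  have hΨfin : hsNorm Ψ ≠ ∞ := by
    rw [hsource]
    exact ((hsNorm_comp_le' _ _).trans_lt (ENNReal.mul_lt_top hF.lt_top (by simp))).ne
  -- The stochastic factor `α⁻¹` has order `n ^ κ`, the bias `G` order `n ^ (-κ * g)`.
  choose G hGn hG using fun n => exists_bias_operator hC hpos hc hlim hβ (hαpos n)
  have hinv : IsBigOInProb P (fun n _ => ENNReal.ofReal (α n)⁻¹) fun n => (n : ℝ) ^ κ := by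
    obtain ⟨K, hK, hb⟩ := hα.2.exists_pos
    refine IsBigOInProb.of_le hK ?_
    filter_upwards [hb.bound, eventually_gt_atTop 0] with n hn hn0 _
    have hn0' : (0 : ℝ) < n := by exact_mod_cast hn0
    rw [Real.norm_of_nonneg (by positivity), Real.norm_of_nonneg (hαpos n).le,
      Real.rpow_neg n.cast_nonneg] at hn
    refine ENNReal.ofReal_le_ofReal ?_
    rw [inv_le_iff_one_le_mul₀ (hαpos n)]
    rw [inv_le_iff_one_le_mul₀ (by positivity)] at hn
    linarith
  have hbias : IsBigOInProb P (fun n _ => ‖G n‖ₑ) fun n => (n : ℝ) ^ (-(g / (2 * (g + 1)))) := by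
    obtain ⟨K, hK, hb⟩ := hα.1.exists_pos
    refine IsBigOInProb.of_le (K := c ^ (β - g) * K ^ g) (by positivity) ?_
    filter_upwards [hb.bound] with n hn _
    rw [Real.norm_of_nonneg (hαpos n).le,
      Real.norm_of_nonneg (Real.rpow_nonneg n.cast_nonneg _)] at hn
    rw [← ofReal_norm]
    refine ENNReal.ofReal_le_ofReal ((hGn n).trans ?_)
    rw [hrate', Real.rpow_mul n.cast_nonneg, mul_assoc, ← Real.mul_rpow hK.le (by positivity)]
    have := (hαpos n).le
    gcongr
  have hD := ((IsBigOInProb.const_rpow (P := P) (k := 1) (by simp) le_rfl).add_rpow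
    ((h.isBigO_sampleC0_sub hX φ).mul_rpow hinv (c := 0) (by linarith)))
  refine (((h.isBigO_sampleC1_sub hX φ hΨfin).mul_rpow hinv hrate.ge).add_rpow
    (IsBigOInProb.const_mul hF (hbias.mul_rpow hD (by linarith)))).mono <|
    Eventually.of_forall fun n => ae_of_all _ fun ω =>
      hsNorm_tikhonov_sub_le (hαpos n) hsource (hG n)

end IsStationaryFAR1

end Rates

end FAR

theorem theorem1
    {Ω : Type*} [MeasurableSpace Ω] (P : Measure Ω) [IsProbabilityMeasure P]
    (Ψ : L2I →L[ℝ] L2I) (X ε : ℤ → Ω → L2I)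
    (hFAR : FAR.IsStationaryFAR1 P Ψ X ε)
    (φ : HilbertBasis ℕ ℝ L2I) (lam : ℕ → ℝ) (c₁ c₂ a : ℝ)
    (hC0 : FAR.CovarianceCondition (FAR.covOp P (X 0)) φ lam c₁ c₂ a)
    (β ρ : ℝ) (hβ : 0 < β) (F : L2I →L[ℝ] L2I)
    (hF : FAR.hsNorm F ≤ ENNReal.ofReal ρ)
    (hsource : Ψ = F ∘L FAR.spectralPow φ lam β)
    (hdep : FAR.LpMApproximable 4 P X)
    (α : ℕ → ℝ) (hαpos : ∀ n, 0 < α n)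
    (hα : α =Θ[atTop] fun n : ℕ => (n : ℝ) ^ (-(1 / (2 * (min β 1 + 1))))) :
    FAR.IsBigOInProb P
        (fun n ω => FAR.hsNorm (FAR.tikhonov n (α n) (fun t => X t ω) - Ψ))
        (fun n => (n : ℝ) ^ (-(min β 1 / (2 * (min β 1 + 1))))) ∧
      (1 ≤ β → FAR.IsBigOInProb P
        (fun n ω => FAR.hsNorm (FAR.tikhonov n (α n) (fun t => X t ω) - Ψ))
        (fun n => (n : ℝ) ^ (-(1 / 4 : ℝ)))) ∧
      (β ≤ 1 → FAR.IsBigOInProb P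
        (fun n ω => FAR.hsNorm (FAR.tikhonov n (α n) (fun t => X t ω) - Ψ))
        (fun n => (n : ℝ) ^ (-(β / (2 * (β + 1)))))) := by
  have hX : MemLp (X 0) 2 P := (hdep.1 0).mono_exponent (by norm_num)
  have hpos : ∀ k, 0 < lam k := fun k =>
    (mul_pos hC0.c₁_pos (by positivity)).trans_le (hC0.decay k).1
  have hc₂ : 0 < c₂ := hC0.c₁_pos.trans_le hC0.c₁_le_c₂
  have ha : 0 < a := one_pos.trans hC0.one_lt_a
  have hle : ∀ k, lam k ≤ c₂ := fun k => (hC0.decay k).2.trans <|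
    mul_le_of_le_one_right hc₂.le <|
      Real.rpow_le_one_of_one_le_of_nonpos (by linarith [k.cast_nonneg (α := ℝ)]) (by linarith)
  have hlim : Tendsto lam atTop (𝓝 0) := by
    have h1 : Tendsto (fun k : ℕ => c₂ * ((k : ℝ) + 1) ^ (-a)) atTop (𝓝 (c₂ * 0)) :=
      ((tendsto_rpow_neg_atTop ha).comp
        (tendsto_atTop_add_const_right _ _ tendsto_natCast_atTop_atTop)).const_mul c₂
    rw [mul_zero] at h1
    exact tendsto_of_tendsto_of_tendsto_of_le_of_le tendsto_const_nhds h1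
      (fun k => (hpos k).le) fun k => (hC0.decay k).2
  have key := hFAR.isBigO_tikhonov_sub hX hC0.eigensystem.apply_eq hpos hle hlim hβ
    (ne_top_of_le_ne_top ENNReal.ofReal_ne_top hF) hsource hαpos hα
  refine ⟨key, fun h => ?_, fun h => ?_⟩
  · rw [min_eq_right h] at key
    norm_num at key ⊢
    exact key
  · rwa [min_eq_left h] at key
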